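/- Let $n\in\mathbb N$, $0<\alpha<1$, let $A$ be a real $n\times n$ matrix, and let $E_\alpha(z)=\sum_{k\ge 0} \frac{z^k}{\Gamma(\alpha k+1)}$ be the Mittag-Leffler function; the series converges for every real number and for every real $n\times n$ matrix $z$. For $t\ge 0$ put $\Phi_t=E_\alpha(At^\alpha):\mathbb R^n\to\mathbb R^n$. A set $S\subseteq\mathbb R^n$ is called invariant if $\Phi_t(S)\subseteq S$ for all $t\ge 0$. The solution curve of $X_0\in\mathbb R^n$ is $C(X_0)=\{\Phi_t X_0: t\ge 0\}$, and $X_0$ is said to lie on an eigenvector of $A$ if $AX_0=\lambda X_0$ for some $\lambda\in\mathbb R$ (so $X_0=0$ is included). 1. For every $X_0\in\mathbb R^n$ the initial value problem ${}_0^C D^\alpha X(t)=AX(t)$ $(t>0)$, $X(0)=X_0$, has exactly one solution $X$ on $[0,\infty)$, namely $X(t)=E_\alpha(At^\alpha)X_0$. Here a solution is a function that is absolutely continuous on every $[0,b]$, takes the value $X_0$ at $0$, and for which, at every $t>0$, the integrand $(t-\tau)^{-\alpha}X'(\tau)$ is integrable on $(0,t)$ and the Caputo derivative ${}_0^C D^\alpha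 X(t)=\frac1{\Gamma(1-\alpha)}\int_0^t (t-\tau)^{-\alpha}X'(\tau)\,d\tau$ equals $AX(t)$. 2. If $X_0$ lies on an eigenvector of $A$, $AX_0=\lambda X_0$, then $\Phi_t X_0=E_\alpha(\lambda t^\alpha)X_0$ for all $t\ge0$, and both the solution curve $C(X_0)$ and the linear span of $X_0$ are invariant. 3. If $X_0$ does not lie on an eigenvector of $A$ and the solution curve $C(X_0)$ is not contained in a straight line, then $C(X_0)$ is not invariant. If $A$ is nonsingular, then $C(X_0)$ is not invariant for every $X_0$ that does not lie on an eigenvector of $A$. -/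

import Mathlib

open MeasureTheory

noncomputable section

namespace FracLin

/-- The Mittag-Leffler function `E_α(z) = ∑ k, z ^ k / Γ(α k + 1)`, for `z` a number or a square
matrix. -/
def mittagLeffler {R : Type*} [Ring R] [Algebra ℝ R] [TopologicalSpace R] (α : ℝ) (z : R) : R :=
  ∑' k : ℕ, (Real.Gamma (α * k + 1))⁻¹ • z ^ k

/-- The integrand `τ ↦ (t - τ) ^ (-α) f'(τ)` of the Caputo derivative of order `0 < α < 1`. -/
def caputoIntegrand {n : ℕ} (α : ℝ) (f : ℝ → Fin n → ℝ) (t τ : ℝ) : Fin n → ℝ :=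
  (t - τ) ^ (-α) • deriv f τ

/-- The Caputo derivative of order `0 < α < 1` with base point `0`:
`(1 / Γ(1 - α)) ∫₀ᵗ (t - τ) ^ (-α) f'(τ) dτ`. -/
def caputoDeriv {n : ℕ} (α : ℝ) (f : ℝ → Fin n → ℝ) (t : ℝ) : Fin n → ℝ :=
  (Real.Gamma (1 - α))⁻¹ • ∫ τ in (0 : ℝ)..t, caputoIntegrand α f t τ

/-- `X` solves the Caputo initial value problem `D^α X = A X`, `X(0) = X₀` on `[0, ∞)`: it is
absolutely continuous on every `[0, b]`, takes the value `X₀` at `0`, and at every `t > 0` the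
Caputo derivative exists and equals `A X(t)`. -/
structure IsSolution {n : ℕ} (α : ℝ) (A : Matrix (Fin n) (Fin n) ℝ) (X₀ : Fin n → ℝ)
    (X : ℝ → Fin n → ℝ) : Prop where
  absolutelyContinuous : ∀ b : ℝ, 0 < b → AbsolutelyContinuousOnInterval X 0 b
  initial : X 0 = X₀
  integrable : ∀ t : ℝ, 0 < t → IntervalIntegrable (caputoIntegrand α X t) volume 0 t
  equation : ∀ t : ℝ, 0 < t → caputoDeriv α X t = A.mulVec (X t)

/-- The map `Φ_t = E_α(A t ^ α)` on `ℝⁿ`. -/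
def flow {n : ℕ} (α : ℝ) (A : Matrix (Fin n) (Fin n) ℝ) (t : ℝ) (x : Fin n → ℝ) : Fin n → ℝ :=
  (mittagLeffler α (t ^ α • A)).mulVec x

/-- The solution curve `{Φ_t(X₀) : t ≥ 0}`. -/
def solutionCurve {n : ℕ} (α : ℝ) (A : Matrix (Fin n) (Fin n) ℝ) (X₀ : Fin n → ℝ) :
    Set (Fin n → ℝ) :=
  (fun t : ℝ => flow α A t X₀) '' Set.Ici 0

/-- `S` is invariant: `Φ_t(S) ⊆ S` for all `t ≥ 0`. -/
def IsInvariant {n : ℕ} (α : ℝ) (A : Matrix (Fin n) (Fin n) ℝ) (S : Set (Fin n → ℝ)) : Prop :=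
  ∀ t : ℝ, 0 ≤ t → flow α A t '' S ⊆ S

/-- `x` lies on an eigenvector of `A`: it is an eigenvector or the equilibrium `0`. -/
def OnEigenvector {n : ℕ} (A : Matrix (Fin n) (Fin n) ℝ) (x : Fin n → ℝ) : Prop :=
  ∃ c : ℝ, A.mulVec x = c • x

end FracLin

end

noncomputable section

namespace FracLin

open MeasureTheory Filter Topology Set

/-! Write `I^β` for the Riemann-Liouville integral. The Beta integral gives `I^a I^b = I^(a+b)`.
Hence a Caputo solution satisfies `X = X₀ + I^1 X' = X₀ + I^α I^(1-α) X' = X₀ + I^α (A X)`, a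
Volterra equation. The Mittag-Leffler curve satisfies the same equation term by term, and iterating
the equation for a difference of two solutions bounds it by general terms of a convergent
Mittag-Leffler series, so it vanishes (`eq_zero_of_eq_rlInt`).

On an eigenvector the flow is multiplication by `e(t) = E_α(c t^α)`, so the curve is invariant once
the values of `e` are closed under products. By continuity this reduces to the range: `[1, ∞)` for
`c > 0`, `{1}` for `c = 0`, `(0, 1]` for `c < 0`. The last case needs positivity, obtained by
excluding a first zero (`pos_of_eq_one_sub_rlInt`).

Off the eigenvectors, suppose first that `A X₀` and `A² X₀` are independent. Invariance would put
the two-parameter family `E_α(xA) E_α(yA) X₀` inside a smooth curve, so every planar Jacobian of it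
vanishes. Expanding the Jacobian at the origin contradicts `c₁² < 2 c₂` for the series coefficients
`c_k = 1/Γ(αk+1)` (`mlCoeff_one_sq_lt`); equality at `α = 1` reflects the semigroup law of the
exponential. If instead `A² X₀ = c A X₀`, the curve lies on a line, and for nonsingular `A`
cancelling one `A` makes `X₀` an eigenvector. -/

/-! ### Convergence of the Mittag-Leffler series -/

theorem tendsto_gamma_div_gamma_add {α : ℝ} (hα₀ : 0 < α) (hα₁ : α < 1) :
    Tendsto (fun x : ℝ => Real.Gamma x / Real.Gamma (x + α)) atTop (𝓝 0) := by
  have hlim : Tendsto (fun x : ℝ => 2 ^ (1 - α) * x ^ (-α)) atTop (𝓝 0) := by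
    simpa using (tendsto_rpow_neg_atTop hα₀).const_mul (2 ^ (1 - α))
  refine squeeze_zero' ?_ ?_ hlim
  · filter_upwards [eventually_gt_atTop 0] with x hx
    exact div_nonneg (Real.Gamma_nonneg_of_nonneg hx.le)
      (Real.Gamma_nonneg_of_nonneg (by positivity))
  · filter_upwards [eventually_ge_atTop 1] with x hx
    have hx0 : 0 < x := by linarith
    have hxa : 0 < x + α := by positivity
    have hG : 0 < Real.Gamma (x + α) := Real.Gamma_pos_of_pos hxa
    -- Log-convexity of `Γ`, with `x + 1` as the mean of `x + α` and `x + α + 1` with weights `α`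
    -- and `1 - α`.
    have h := Real.Gamma_mul_add_mul_le_rpow_Gamma_mul_rpow_Gamma hxa
      (show 0 < x + α + 1 by positivity) hα₀ (sub_pos.2 hα₁) (by ring)
    rw [show α * (x + α) + (1 - α) * (x + α + 1) = x + 1 by ring, Real.Gamma_add_one hx0.ne',
      Real.Gamma_add_one hxa.ne', Real.mul_rpow hxa.le hG.le] at h
    have h2 : Real.Gamma (x + α) ^ α * ((x + α) ^ (1 - α) * Real.Gamma (x + α) ^ (1 - α))
        = (x + α) ^ (1 - α) * Real.Gamma (x + α) := by
      rw [mul_left_comm, ← Real.rpow_add hG]; simp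
    rw [h2] at h
    have h3 : (x + α) ^ (1 - α) ≤ 2 ^ (1 - α) * x ^ (1 - α) := by
      rw [← Real.mul_rpow (by norm_num) hx0.le]
      exact Real.rpow_le_rpow hxa.le (by linarith) (by linarith)
    have h4 : x ^ (1 - α) = x * x ^ (-α) := by
      rw [sub_eq_add_neg, Real.rpow_add hx0, Real.rpow_one]
    rw [div_le_iff₀ hG]
    rw [h4] at h3
    have h5 : x * Real.Gamma x ≤ x * (2 ^ (1 - α) * x ^ (-α) * Real.Gamma (x + α)) := by
      calc _ ≤ _ := h
        _ ≤ (2 ^ (1 - α) * (x * x ^ (-α))) * Real.Gamma (x + α) := by gcongr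
        _ = _ := by ring
    exact le_of_mul_le_mul_left h5 hx0

/-- The `k`-th coefficient of the Mittag-Leffler series. -/
def mlCoeff (α : ℝ) (k : ℕ) : ℝ := (Real.Gamma (α * k + 1))⁻¹

theorem mlCoeff_pos {α : ℝ} (hα₀ : 0 < α) (k : ℕ) : 0 < mlCoeff α k :=
  inv_pos.2 (Real.Gamma_pos_of_pos (by positivity))

@[simp] theorem mlCoeff_zero (α : ℝ) : mlCoeff α 0 = 1 := by simp [mlCoeff]

/-- Ratio test: consecutive terms have ratio `r Γ(y)/Γ(y+α)` with `y = αk + 1`, which tends to `0`.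
It is run for `r > 0`, where no term vanishes; general `r` is dominated by `|r| + 1`. -/
theorem summable_pow_mul_mlCoeff {α : ℝ} (hα₀ : 0 < α) (hα₁ : α < 1) (r : ℝ) :
    Summable fun k : ℕ => r ^ k * mlCoeff α k := by
  have main : ∀ r : ℝ, 0 < r → Summable fun k : ℕ => r ^ k * mlCoeff α k := by
    intro r hr
    refine summable_of_ratio_test_tendsto_lt_one (l := 0) one_pos
      (Eventually.of_forall fun k => (mul_pos (pow_pos hr k) (mlCoeff_pos hα₀ k)).ne') ?_
    have hlin : Tendsto (fun k : ℕ => α * (k : ℝ) + 1) atTop atTop :=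
      tendsto_atTop_add_const_right _ _ (tendsto_natCast_atTop_atTop.const_mul_atTop hα₀)
    have h := ((tendsto_gamma_div_gamma_add hα₀ hα₁).comp hlin).const_mul r
    rw [mul_zero] at h
    refine h.congr fun k => ?_
    have h1 := mlCoeff_pos hα₀ k
    have h2 := mlCoeff_pos hα₀ (k + 1)
    rw [Real.norm_of_nonneg (by positivity), Real.norm_of_nonneg (by positivity)]
    simp only [Function.comp, mlCoeff]
    rw [show α * ((k + 1 : ℕ) : ℝ) + 1 = α * k + 1 + α by push_cast; ring]
    have := Real.Gamma_pos_of_pos (show 0 < α * (k : ℝ) + 1 by positivity)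
    have := Real.Gamma_pos_of_pos (show 0 < α * (k : ℝ) + 1 + α by positivity)
    field_simp
    ring
  refine Summable.of_norm_bounded (main (|r| + 1) (by positivity)) fun k => ?_
  rw [norm_mul, norm_pow, Real.norm_eq_abs, Real.norm_of_nonneg (mlCoeff_pos hα₀ k).le]
  have := (mlCoeff_pos hα₀ k).le
  gcongr
  linarith

/-! ### Everywhere convergent power series with vector coefficients -/

section Series

variable {E : Type*} [NormedAddCommGroup E] [NormedSpace ℝ E]

/-- The coefficients of an everywhere absolutely convergent power series. -/
def EntireCoeff (a : ℕ → E) : Prop := ∀ r : ℝ, 0 ≤ r → Summable fun k : ℕ => r ^ k * ‖a k‖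

/-- The sum of a power series in one real variable. -/
def series (a : ℕ → E) (x : ℝ) : E := ∑' k : ℕ, x ^ k • a k

/-- The coefficients of the differentiated power series. -/
def derivCoeff (a : ℕ → E) (k : ℕ) : E := ((k : ℝ) + 1) • a (k + 1)

theorem series_zero (a : ℕ → E) : series a 0 = a 0 := by
  rw [series, tsum_eq_single 0 (fun k hk => by simp [hk])]
  simp

theorem EntireCoeff.derivCoeff {a : ℕ → E} (ha : EntireCoeff a) :
    EntireCoeff (derivCoeff a) := by
  intro r hr
  refine Summable.of_nonneg_of_le (fun k => by positivity) (fun k => ?_)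
    ((summable_nat_add_iff 1).2 (ha (2 * (r + 1)) (by positivity)))
  rw [FracLin.derivCoeff, norm_smul, Real.norm_of_nonneg (by positivity), ← mul_assoc, mul_pow]
  -- The factor produced by differentiation is absorbed by doubling the radius.
  have h1 : ((k : ℝ) + 1) ≤ 2 ^ (k + 1) := by exact_mod_cast (Nat.lt_two_pow_self (n := k + 1)).le
  have h2 : r ^ k ≤ (r + 1) ^ (k + 1) :=
    (pow_le_pow_left₀ hr (by linarith) k).trans (pow_le_pow_right₀ (by linarith) (by omega))
  rw [mul_comm (r ^ k)]
  gcongr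

variable [CompleteSpace E]

theorem EntireCoeff.summable {a : ℕ → E} (ha : EntireCoeff a) (x : ℝ) :
    Summable fun k : ℕ => x ^ k • a k := by
  refine Summable.of_norm_bounded (ha |x| (abs_nonneg x)) fun k => ?_
  rw [norm_smul, norm_pow, Real.norm_eq_abs]

theorem EntireCoeff.hasDerivAt {a : ℕ → E} (ha : EntireCoeff a) (x : ℝ) :
    HasDerivAt (series a) (series (FracLin.derivCoeff a) x) x := by
  set R : ℝ := |x| + 1
  have hR : 0 ≤ R := by positivity
  have hu : Summable fun k : ℕ => (k : ℝ) * R ^ (k - 1) * ‖a k‖ := by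
    rw [← summable_nat_add_iff 1]
    refine (ha.derivCoeff R hR).congr fun k => ?_
    rw [FracLin.derivCoeff, norm_smul, Real.norm_of_nonneg (by positivity)]
    push_cast
    ring
  have hx : x ∈ Metric.ball (0 : ℝ) R := by simp [R]
  have h := hasDerivAt_tsum_of_isPreconnected (g := fun (k : ℕ) (y : ℝ) => y ^ k • a k)
    (g' := fun (k : ℕ) (y : ℝ) => ((k : ℝ) * y ^ (k - 1)) • a k) hu Metric.isOpen_ball
    (convex_ball (0 : ℝ) R).isPreconnected
    (fun k y _ => (hasDerivAt_pow k y).smul_const (a k))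
    (fun k y hy => by
      rw [norm_smul, norm_mul, norm_pow, Real.norm_of_nonneg (Nat.cast_nonneg k)]
      have : ‖y‖ ≤ R := by simpa using (mem_ball_zero_iff.1 hy).le
      gcongr)
    hx (ha.summable x) hx
  have hs : (∑' k : ℕ, ((k : ℝ) * x ^ (k - 1)) • a k) = series (FracLin.derivCoeff a) x := by
    have h0 : Summable fun k : ℕ => ((k : ℝ) * x ^ (k - 1)) • a k := by
      refine Summable.of_norm_bounded hu fun k => ?_
      rw [norm_smul, norm_mul, norm_pow, Real.norm_of_nonneg (Nat.cast_nonneg k)]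
      have : ‖x‖ ≤ R := by simp [R]
      gcongr
    rw [h0.tsum_eq_zero_add]
    simp only [Nat.cast_zero, zero_mul, zero_smul, zero_add, Nat.add_sub_cancel, series,
      FracLin.derivCoeff, smul_smul]
    refine tsum_congr fun k => ?_
    push_cast
    rw [mul_comm]
  rw [hs] at h
  exact h

theorem EntireCoeff.continuous {a : ℕ → E} (ha : EntireCoeff a) : Continuous (series a) :=
  continuous_iff_continuousAt.2 fun x => (ha.hasDerivAt x).continuousAt

theorem EntireCoeff.contDiff {a : ℕ → E} (ha : EntireCoeff a) : ContDiff ℝ 1 (series a) := by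
  rw [contDiff_one_iff_deriv]
  refine ⟨fun x => (ha.hasDerivAt x).differentiableAt, ?_⟩
  rw [show deriv (series a) = series (FracLin.derivCoeff a) from
    funext fun x => (ha.hasDerivAt x).deriv]
  exact ha.derivCoeff.continuous

end Series

/-! ### Mittag-Leffler series of an operator -/

section MittagLefflerSeries

variable {E : Type*} [NormedAddCommGroup E] [NormedSpace ℝ E]

/-- The coefficients of `x ↦ E_α(x T) v`. -/
def orbitCoeff (α : ℝ) (T : E →L[ℝ] E) (v : E) (k : ℕ) : E := mlCoeff α k • (T ^ k) v

/-- The coefficients of `x ↦ E_α(x T)`. -/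
def opCoeff (α : ℝ) (T : E →L[ℝ] E) (k : ℕ) : E →L[ℝ] E := mlCoeff α k • T ^ k

theorem entireCoeff_opCoeff {α : ℝ} (hα₀ : 0 < α) (hα₁ : α < 1) (T : E →L[ℝ] E) :
    EntireCoeff (opCoeff α T) := by
  intro r hr
  refine Summable.of_nonneg_of_le (fun k => by positivity) (fun k => ?_)
    (summable_pow_mul_mlCoeff hα₀ hα₁ (r * ‖T‖))
  rw [opCoeff, norm_smul, Real.norm_of_nonneg (mlCoeff_pos hα₀ k).le, mul_pow]
  have h := mlCoeff_pos hα₀ k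
  have hT : ‖T ^ k‖ ≤ ‖T‖ ^ k := by
    -- The space may be trivial, so the identity is only known to have norm at most `1`.
    rcases Nat.eq_zero_or_pos k with rfl | hk
    · rw [pow_zero, pow_zero]; exact ContinuousLinearMap.norm_id_le
    · exact norm_pow_le' T hk
  calc r ^ k * (mlCoeff α k * ‖T ^ k‖) ≤ r ^ k * (mlCoeff α k * ‖T‖ ^ k) := by gcongr
    _ = _ := by ring

theorem entireCoeff_orbitCoeff {α : ℝ} (hα₀ : 0 < α) (hα₁ : α < 1) (T : E →L[ℝ] E) (v : E) :
    EntireCoeff (orbitCoeff α T v) := by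
  intro r hr
  refine Summable.of_nonneg_of_le (fun k => by positivity) (fun k => ?_)
    ((entireCoeff_opCoeff hα₀ hα₁ T r hr).mul_right ‖v‖)
  rw [mul_assoc]
  gcongr
  exact (opCoeff α T k).le_opNorm v

theorem series_opCoeff_apply [CompleteSpace E] {α : ℝ} (hα₀ : 0 < α) (hα₁ : α < 1)
    (T : E →L[ℝ] E) (v : E) (x : ℝ) :
    series (opCoeff α T) x v = series (orbitCoeff α T v) x := by
  have h := (ContinuousLinearMap.apply ℝ E v).map_tsum
    ((entireCoeff_opCoeff hα₀ hα₁ T).summable x)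
  simpa [series, opCoeff, orbitCoeff] using h

end MittagLefflerSeries

/-! ### Riemann-Liouville kernels and the Beta integral -/

/-- The Riemann-Liouville kernel `x ↦ x ^ (β - 1) / Γ(β)` on `x > 0`, extended by zero. -/
def fracKernel (β x : ℝ) : ℝ := if 0 < x then x ^ (β - 1) / Real.Gamma β else 0

theorem fracKernel_of_pos {β x : ℝ} (hx : 0 < x) :
    fracKernel β x = x ^ (β - 1) / Real.Gamma β := if_pos hx

theorem fracKernel_of_nonpos {β x : ℝ} (hx : x ≤ 0) : fracKernel β x = 0 := if_neg hx.not_gt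

theorem fracKernel_nonneg {β : ℝ} (hβ : 0 < β) (x : ℝ) : 0 ≤ fracKernel β x := by
  have := Real.Gamma_pos_of_pos hβ
  unfold fracKernel
  split_ifs <;> positivity

theorem fracKernel_one_of_pos {x : ℝ} (hx : 0 < x) : fracKernel 1 x = 1 := by
  simp [fracKernel_of_pos hx]

theorem measurable_fracKernel (β : ℝ) : Measurable (fracKernel β) := by
  unfold fracKernel
  exact Measurable.ite measurableSet_Ioi (by fun_prop) measurable_const

theorem integral_rpow_mul_rpow_sub {a b x : ℝ} (ha : 0 < a) (hb : 0 < b) (hx : 0 < x) :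
    ∫ s in Ioc 0 x, s ^ (b - 1) * (x - s) ^ (a - 1)
      = x ^ (a + b - 1) * (Real.Gamma a * Real.Gamma b / Real.Gamma (a + b)) := by
  have h := Complex.betaIntegral_scaled (b : ℂ) (a : ℂ) hx
  rw [Complex.betaIntegral_eq_Gamma_mul_div _ _ (by simpa using hb) (by simpa using ha),
    ← Complex.ofReal_add, Complex.Gamma_ofReal, Complex.Gamma_ofReal, Complex.Gamma_ofReal,
    intervalIntegral.integral_of_le hx.le] at h
  have h2 : ∫ s in Ioc 0 x, ((s : ℂ) ^ ((b : ℂ) - 1) * ((x : ℂ) - s) ^ ((a : ℂ) - 1))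
      = ((∫ s in Ioc 0 x, s ^ (b - 1) * (x - s) ^ (a - 1) : ℝ) : ℂ) := by
    rw [← integral_complex_ofReal]
    refine setIntegral_congr_fun measurableSet_Ioc fun s hs => ?_
    simp only [Complex.ofReal_mul]
    rw [← Complex.ofReal_sub, ← Complex.ofReal_one, ← Complex.ofReal_sub, ← Complex.ofReal_sub,
      ← Complex.ofReal_cpow hs.1.le, ← Complex.ofReal_cpow (by linarith [hs.2])]
  rw [h2, ← Complex.ofReal_one, ← Complex.ofReal_sub, ← Complex.ofReal_cpow hx.le] at h
  have h3 := congrArg Complex.re h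
  norm_cast at h3
  rw [h3, add_comm b a, mul_comm (Real.Gamma b)]

theorem fracKernel_mul_eq_indicator (a b : ℝ) (x : ℝ) :
    (fun s => fracKernel a (x - s) * fracKernel b s) = (Ioo 0 x).indicator fun s =>
      (Real.Gamma a * Real.Gamma b)⁻¹ * (s ^ (b - 1) * (x - s) ^ (a - 1)) := by
  ext s
  by_cases hs : s ∈ Ioo 0 x
  · rw [indicator_of_mem hs, fracKernel_of_pos (sub_pos.2 hs.2), fracKernel_of_pos hs.1]
    rw [mul_inv]
    ring
  · rw [indicator_of_notMem hs]
    by_cases h0 : 0 < s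
    · rw [fracKernel_of_nonpos (sub_nonpos.2 (not_lt.1 fun h => hs ⟨h0, h⟩)), zero_mul]
    · rw [fracKernel_of_nonpos (not_lt.1 h0), mul_zero]

/-- The Beta integral makes the kernels a convolution semigroup. Extension by zero restricts the
integrand to `0 < s < x`, so no sign condition on `x` is needed. -/
theorem integral_fracKernel_mul {a b : ℝ} (ha : 0 < a) (hb : 0 < b) (x : ℝ) :
    ∫ s, fracKernel a (x - s) * fracKernel b s = fracKernel (a + b) x := by
  rw [fracKernel_mul_eq_indicator]
  rcases le_or_gt x 0 with hx | hx
  · rw [Ioo_eq_empty (not_lt.2 hx), fracKernel_of_nonpos hx]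
    simp
  · rw [integral_indicator measurableSet_Ioo, ← integral_Ioc_eq_integral_Ioo,
      integral_const_mul, integral_rpow_mul_rpow_sub ha hb hx, fracKernel_of_pos hx]
    have := Real.Gamma_pos_of_pos ha
    have := Real.Gamma_pos_of_pos hb
    have := Real.Gamma_pos_of_pos (add_pos ha hb)
    field_simp

theorem integrable_fracKernel_mul {a b : ℝ} (ha : 0 < a) (hb : 0 < b) (x : ℝ) :
    Integrable fun s => fracKernel a (x - s) * fracKernel b s := by
  rcases le_or_gt x 0 with hx | hx
  · rw [fracKernel_mul_eq_indicator, Ioo_eq_empty (not_lt.2 hx)]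
    simp
  -- A non-integrable function has Bochner integral `0`, so the nonzero value already proves
  -- integrability.
  · refine Integrable.of_integral_ne_zero ?_
    rw [integral_fracKernel_mul ha hb, fracKernel_of_pos hx]
    have := Real.Gamma_pos_of_pos (add_pos ha hb)
    positivity

/-! ### Fractional integrals: semigroup law and termwise integration -/

section RL

variable {E : Type*} [NormedAddCommGroup E] [NormedSpace ℝ E]

/-- The Riemann-Liouville fractional integral of order `β` with base point `0`. -/
def rlInt (β : ℝ) (f : ℝ → E) (t : ℝ) : E := ∫ s in Ioi 0, fracKernel β (t - s) • f s

theorem rlInt_eq_intervalIntegral (β : ℝ) (f : ℝ → E) {t : ℝ} (ht : 0 ≤ t) :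
    rlInt β f t = ∫ s in (0 : ℝ)..t, fracKernel β (t - s) • f s := by
  rw [rlInt, intervalIntegral.integral_of_le ht]
  refine setIntegral_eq_of_subset_of_forall_sdiff_eq_zero measurableSet_Ioi Ioc_subset_Ioi_self ?_
  rintro s ⟨hs, hs'⟩
  rw [fracKernel_of_nonpos, zero_smul]
  exact sub_nonpos.2 (not_lt.1 fun h => hs' ⟨hs, h.le⟩)

theorem rlInt_of_nonpos (β : ℝ) (f : ℝ → E) {t : ℝ} (ht : t ≤ 0) : rlInt β f t = 0 := by
  refine setIntegral_eq_zero_of_forall_eq_zero fun s hs => ?_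
  rw [fracKernel_of_nonpos (by linarith [mem_Ioi.1 hs]), zero_smul]

theorem rlInt_congr (β : ℝ) {f g : ℝ → E} {t : ℝ} (h : ∀ s, 0 < s → s < t → f s = g s) :
    rlInt β f t = rlInt β g t := by
  refine setIntegral_congr_fun measurableSet_Ioi fun s hs => ?_
  by_cases hst : s < t
  · simp only [h s hs hst]
  · simp only [fracKernel_of_nonpos (sub_nonpos.2 (not_lt.1 hst)), zero_smul]

/-- Fubini and the convolution identity of the kernels. As the kernels are nonnegative, integrating
the norm in `s` first gives exactly the kernel of order `a + b`, so integrability against that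
kernel suffices. -/
theorem rlInt_rlInt [CompleteSpace E] {a b : ℝ} (ha : 0 < a) (hb : 0 < b) {g : ℝ → E} {t : ℝ}
    (hg : AEStronglyMeasurable g (volume.restrict (Ioi 0)))
    (hint : IntegrableOn (fun r => fracKernel (a + b) (t - r) • g r) (Ioi 0)) :
    rlInt a (rlInt b g) t = rlInt (a + b) g t := by
  have hswap : ∀ r, ∫ s, fracKernel a (t - s) * fracKernel b (s - r)
      = fracKernel (a + b) (t - r) := by
    intro r
    rw [← integral_fracKernel_mul ha hb,
      ← integral_sub_right_eq_self (fun s => fracKernel a (t - r - s) * fracKernel b s) r]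
    simp
  have hint' : ∀ r, Integrable fun s => fracKernel a (t - s) * fracKernel b (s - r) := by
    intro r
    have := (integrable_fracKernel_mul ha hb (t - r)).comp_sub_right r
    simpa using this
  have hprod : Integrable (Function.uncurry fun s r =>
      (fracKernel a (t - s) * fracKernel b (s - r)) • g r)
      (volume.prod (volume.restrict (Ioi 0))) := by
    have hm : AEStronglyMeasurable (Function.uncurry fun s r =>
        (fracKernel a (t - s) * fracKernel b (s - r)) • g r)
        (volume.prod (volume.restrict (Ioi (0 : ℝ)))) := by
      refine AEStronglyMeasurable.smul (Measurable.aestronglyMeasurable ?_) hg.comp_snd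
      exact ((measurable_fracKernel a).comp (measurable_const.sub measurable_fst)).mul
        ((measurable_fracKernel b).comp (measurable_fst.sub measurable_snd))
    rw [integrable_prod_iff' hm]
    refine ⟨Eventually.of_forall fun r => (hint' r).smul_const (g r), ?_⟩
    refine hint.norm.congr (Eventually.of_forall fun r => ?_)
    simp only [Function.uncurry, norm_smul]
    rw [integral_mul_const]
    congr 1
    rw [Real.norm_of_nonneg (fracKernel_nonneg (add_pos ha hb) _), ← hswap]
    refine integral_congr_ae (Eventually.of_forall fun s => ?_)
    exact (Real.norm_of_nonneg (mul_nonneg (fracKernel_nonneg ha _) (fracKernel_nonneg hb _))).symm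
  have hout : rlInt a (rlInt b g) t = ∫ s, fracKernel a (t - s) • rlInt b g s := by
    refine setIntegral_eq_integral_of_forall_compl_eq_zero fun s hs => ?_
    rw [rlInt_of_nonpos b g (not_lt.1 hs), smul_zero]
  rw [hout]
  have h := integral_integral_swap hprod
  simp only [integral_smul_const, hswap] at h
  rw [rlInt, ← h]
  refine integral_congr_ae (Eventually.of_forall fun s => ?_)
  simp only [rlInt, mul_smul, integral_smul]

/-- Nonnegative kernels make the integrals of the norms equal to the terms in `hs`, which therefore
justifies exchanging sum and integral. -/
theorem rlInt_tsum_fracKernel [CompleteSpace E] {β : ℝ} (hβ : 0 < β) {b : ℕ → ℝ}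
    (hb : ∀ k, 0 < b k) (v : ℕ → E) {t : ℝ}
    (hs : Summable fun k => fracKernel (b k + β) t * ‖v k‖) :
    rlInt β (fun s => ∑' k, fracKernel (b k) s • v k) t = ∑' k, fracKernel (b k + β) t • v k := by
  have hk : ∀ k, ∫ s in Ioi 0, fracKernel β (t - s) * fracKernel (b k) s
      = fracKernel (b k + β) t := by
    intro k
    rw [add_comm, ← integral_fracKernel_mul hβ (hb k)]
    refine setIntegral_eq_integral_of_forall_compl_eq_zero fun s hs => ?_
    rw [fracKernel_of_nonpos (not_lt.1 hs), mul_zero]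
  have h := hasSum_integral_of_summable_integral_norm
    (F := fun k s => (fracKernel β (t - s) * fracKernel (b k) s) • v k)
    (μ := volume.restrict (Ioi 0))
    (fun k => (integrable_fracKernel_mul hβ (hb k) t).integrableOn.smul_const _)
    (hs.congr fun k => by
      simp only [norm_smul]
      rw [integral_mul_const, ← hk]
      congr 1
      refine integral_congr_ae (Eventually.of_forall fun s => ?_)
      exact (Real.norm_of_nonneg
        (mul_nonneg (fracKernel_nonneg hβ _) (fracKernel_nonneg (hb k) _))).symm)
  simp only [integral_smul_const, hk] at h
  rw [h.tsum_eq, rlInt]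
  refine integral_congr_ae (Eventually.of_forall fun s => ?_)
  simp only [mul_smul]
  exact (tsum_const_smul'' (fracKernel β (t - s))).symm

end RL

/-! ### The Volterra equation and its Mittag-Leffler solution -/

section Volterra

variable {E : Type*} [NormedAddCommGroup E] [NormedSpace ℝ E]

theorem integrableOn_fracKernel_smul {a b C t : ℝ} (ha : 0 < a) (hb : 0 < b) {f : ℝ → E}
    (hf : AEStronglyMeasurable f (volume.restrict (Ioo 0 t)))
    (hC : ∀ s, 0 < s → s < t → ‖f s‖ ≤ C * fracKernel b s) :
    IntegrableOn (fun s => fracKernel a (t - s) • f s) (Ioi 0) := by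
  have h : IntegrableOn (fun s => fracKernel a (t - s) • f s) (Ioo 0 t) := by
    refine Integrable.mono' (((integrable_fracKernel_mul ha hb t).const_mul C).integrableOn) ?_ ?_
    · exact ((measurable_fracKernel a).comp
        (measurable_const.sub measurable_id)).aestronglyMeasurable.smul hf
    · filter_upwards [ae_restrict_mem measurableSet_Ioo] with s hs
      rw [norm_smul, Real.norm_of_nonneg (fracKernel_nonneg ha _)]
      calc _ ≤ fracKernel a (t - s) * (C * fracKernel b s) :=
            mul_le_mul_of_nonneg_left (hC s hs.1 hs.2) (fracKernel_nonneg ha _)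
        _ = _ := by ring
  refine h.of_forall_sdiff_eq_zero measurableSet_Ioi ?_
  rintro s ⟨hs, hs'⟩
  rw [fracKernel_of_nonpos, zero_smul]
  exact sub_nonpos.2 (not_lt.1 fun h => hs' ⟨hs, h⟩)

theorem integrableOn_fracKernel_smul_of_continuousOn {a t : ℝ} (ha : 0 < a) {f : ℝ → E}
    (hf : ContinuousOn f (Icc 0 t)) :
    IntegrableOn (fun s => fracKernel a (t - s) • f s) (Ioi 0) := by
  obtain ⟨C, hC⟩ := isCompact_Icc.exists_bound_of_continuousOn hf
  refine integrableOn_fracKernel_smul (C := C) ha one_pos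
    ((hf.mono Ioo_subset_Icc_self).aestronglyMeasurable measurableSet_Ioo) fun s h0 h1 => ?_
  rw [fracKernel_one_of_pos h0, mul_one]
  exact hC s ⟨h0.le, h1.le⟩

theorem fracKernel_mlCoeff (α : ℝ) (k : ℕ) {t : ℝ} (ht : 0 < t) :
    fracKernel (α * k + 1) t = (t ^ α) ^ k * mlCoeff α k := by
  rw [fracKernel_of_pos ht, add_sub_cancel_right, Real.rpow_mul ht.le, Real.rpow_natCast, mlCoeff,
    div_eq_mul_inv]

/-- From `Γ(αk+α+1) = α(k+1) Γ(αk+α)`. The right side is what the chain rule through `t ↦ t ^ α`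
produces, so the differentiated curve is again a series of kernels. -/
theorem fracKernel_derivCoeff {α : ℝ} (hα₀ : 0 < α) (k : ℕ) {t : ℝ} (ht : 0 < t) :
    fracKernel (α * k + α) t
      = α * t ^ (α - 1) * ((t ^ α) ^ k * ((k + 1) * mlCoeff α (k + 1))) := by
  have hp : 0 < α * k + α := by positivity
  have hG := Real.Gamma_pos_of_pos hp
  rw [fracKernel_of_pos ht, mlCoeff, show α * ((k + 1 : ℕ) : ℝ) + 1 = α * k + α + 1 by
    push_cast; ring, Real.Gamma_add_one hp.ne', ← Real.rpow_natCast, ← Real.rpow_mul ht.le,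
    show α * k + α - 1 = (α - 1) + α * k by ring, Real.rpow_add ht]
  have : (k : ℝ) + 1 ≠ 0 := by positivity
  field_simp

/-- The curve `t ↦ E_α(t ^ α T) v`. -/
def orbit (α : ℝ) (T : E →L[ℝ] E) (v : E) (t : ℝ) : E := series (orbitCoeff α T v) (t ^ α)

theorem orbit_zero {α : ℝ} (hα₀ : 0 < α) (T : E →L[ℝ] E) (v : E) : orbit α T v 0 = v := by
  rw [orbit, Real.zero_rpow hα₀.ne', series_zero]
  simp [orbitCoeff]

theorem orbit_eq_tsum (α : ℝ) (T : E →L[ℝ] E) (v : E) {t : ℝ} (ht : 0 < t) :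
    orbit α T v t = ∑' k : ℕ, fracKernel (α * k + 1) t • (T ^ k) v := by
  simp only [orbit, series, orbitCoeff, fracKernel_mlCoeff α _ ht, smul_smul]

theorem summable_fracKernel_mul_norm {α : ℝ} (hα₀ : 0 < α) (hα₁ : α < 1) (T : E →L[ℝ] E) (v : E)
    {t : ℝ} (ht : 0 < t) : Summable fun k : ℕ => fracKernel (α * k + 1) t * ‖(T ^ k) v‖ := by
  refine (entireCoeff_orbitCoeff hα₀ hα₁ T v (t ^ α) (by positivity)).congr fun k => ?_
  rw [fracKernel_mlCoeff α _ ht, orbitCoeff, norm_smul, Real.norm_of_nonneg (mlCoeff_pos hα₀ k).le,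
    mul_assoc]

/-- Each substitution of the equation into itself gains a factor `‖T‖` and raises the kernel order
by `α`. The resulting bounds are terms of a convergent Mittag-Leffler series, hence tend to `0`. -/
theorem eq_zero_of_eq_rlInt {α : ℝ} (hα₀ : 0 < α) (hα₁ : α < 1) (T : E →L[ℝ] E) {W : ℝ → E}
    {b : ℝ} (hW : ContinuousOn W (Icc 0 b))
    (h : ∀ t, 0 < t → t ≤ b → W t = rlInt α (fun s => T (W s)) t) {t : ℝ} (h0 : 0 < t)
    (hb : t ≤ b) : W t = 0 := by
  obtain ⟨M, hM⟩ := isCompact_Icc.exists_bound_of_continuousOn hW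
  have key : ∀ k : ℕ, ∀ t, 0 < t → t ≤ b → ‖W t‖ ≤ M * ‖T‖ ^ k * fracKernel (α * k + 1) t := by
    intro k
    induction k with
    | zero =>
      intro t h0 hb
      simpa [fracKernel_one_of_pos h0] using hM t ⟨h0.le, hb⟩
    | succ k ih =>
      intro t h0 hb
      have hk : 0 < α * k + 1 := by positivity
      have hint := (integrable_fracKernel_mul hα₀ hk t).const_mul (M * ‖T‖ ^ (k + 1))
      rw [h t h0 hb]
      have hle := norm_integral_le_of_norm_le (μ := volume.restrict (Ioi 0))
        (f := fun s => fracKernel α (t - s) • T (W s)) hint.integrableOn (by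
          filter_upwards [ae_restrict_mem measurableSet_Ioi] with s hs
          rw [norm_smul, Real.norm_of_nonneg (fracKernel_nonneg hα₀ _)]
          by_cases hst : s < t
          · have h1 := (T.le_opNorm (W s)).trans
              (mul_le_mul_of_nonneg_left (ih s hs (by linarith)) (norm_nonneg T))
            calc _ ≤ fracKernel α (t - s) * (‖T‖ * (M * ‖T‖ ^ k * fracKernel (α * k + 1) s)) :=
                  mul_le_mul_of_nonneg_left h1 (fracKernel_nonneg hα₀ _)
              _ = _ := by ring
          · rw [fracKernel_of_nonpos (sub_nonpos.2 (not_lt.1 hst))]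
            simp)
      refine hle.trans (le_of_eq ?_)
      rw [setIntegral_eq_integral_of_forall_compl_eq_zero, integral_const_mul,
        integral_fracKernel_mul hα₀ hk]
      · congr 2
        push_cast
        ring
      · intro s hs
        rw [fracKernel_of_nonpos (not_lt.1 hs)]
        simp
  have hlim : Tendsto (fun k : ℕ => M * ((‖T‖ * t ^ α) ^ k * mlCoeff α k)) atTop (𝓝 0) := by
    simpa using ((summable_pow_mul_mlCoeff hα₀ hα₁ (‖T‖ * t ^ α)).tendsto_atTop_zero).const_mul M
  have hle : ‖W t‖ ≤ 0 := by
    refine ge_of_tendsto' hlim fun k => (key k t h0 hb).trans (le_of_eq ?_)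
    rw [fracKernel_mlCoeff α k h0, mul_pow]
    ring
  exact norm_le_zero_iff.1 hle

variable [CompleteSpace E]

theorem continuous_orbit {α : ℝ} (hα₀ : 0 < α) (hα₁ : α < 1) (T : E →L[ℝ] E) (v : E) :
    Continuous (orbit α T v) :=
  (entireCoeff_orbitCoeff hα₀ hα₁ T v).continuous.comp
    (Real.continuous_rpow_const hα₀.le)

theorem hasDerivAt_orbit {α : ℝ} (hα₀ : 0 < α) (hα₁ : α < 1) (T : E →L[ℝ] E) (v : E) {t : ℝ}
    (ht : 0 < t) : HasDerivAt (orbit α T v)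
      ((α * t ^ (α - 1)) • series (derivCoeff (orbitCoeff α T v)) (t ^ α)) t :=
  ((entireCoeff_orbitCoeff hα₀ hα₁ T v).hasDerivAt (t ^ α)).scomp t
    (Real.hasDerivAt_rpow_const (Or.inl ht.ne'))

theorem deriv_orbit_eq_tsum {α : ℝ} (hα₀ : 0 < α) (hα₁ : α < 1) (T : E →L[ℝ] E) (v : E) {t : ℝ}
    (ht : 0 < t) :
    deriv (orbit α T v) t = ∑' k : ℕ, fracKernel (α * k + α) t • (T ^ (k + 1)) v := by
  rw [(hasDerivAt_orbit hα₀ hα₁ T v ht).deriv, series, ← tsum_const_smul'']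
  refine tsum_congr fun k => ?_
  rw [fracKernel_derivCoeff hα₀ k ht, derivCoeff, orbitCoeff, smul_smul, smul_smul, smul_smul]
  simp only [mul_assoc]

theorem map_orbit_eq_tsum {α : ℝ} (hα₀ : 0 < α) (hα₁ : α < 1) (T : E →L[ℝ] E) (v : E) {t : ℝ}
    (ht : 0 < t) :
    T (orbit α T v t) = ∑' k : ℕ, fracKernel (α * k + 1) t • (T ^ (k + 1)) v := by
  rw [orbit_eq_tsum α T v ht, T.map_tsum]
  · simp only [map_smul, pow_succ', mul_apply_eq_comp]
  · refine Summable.of_norm_bounded (summable_fracKernel_mul_norm hα₀ hα₁ T v ht) fun k => ?_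
    rw [norm_smul, Real.norm_of_nonneg (fracKernel_nonneg (by positivity) _)]

theorem rlInt_deriv_orbit {α : ℝ} (hα₀ : 0 < α) (hα₁ : α < 1) (T : E →L[ℝ] E) (v : E) {t : ℝ}
    (ht : 0 < t) : rlInt (1 - α) (deriv (orbit α T v)) t = T (orbit α T v t) := by
  have h : ∀ k : ℕ, α * k + α + (1 - α) = α * k + 1 := fun k => by ring
  rw [rlInt_congr (1 - α) fun s hs _ => deriv_orbit_eq_tsum hα₀ hα₁ T v hs,
    rlInt_tsum_fracKernel (sub_pos.2 hα₁) (fun k => by positivity), map_orbit_eq_tsum hα₀ hα₁ T v ht]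
  · simp only [h]
  · simp only [h, pow_succ, mul_apply_eq_comp]
    exact summable_fracKernel_mul_norm hα₀ hα₁ T (T v) ht

theorem orbit_eq_add_rlInt {α : ℝ} (hα₀ : 0 < α) (hα₁ : α < 1) (T : E →L[ℝ] E) (v : E) {t : ℝ}
    (ht : 0 < t) : orbit α T v t = v + rlInt α (fun s => T (orbit α T v s)) t := by
  have h : ∀ k : ℕ, α * k + 1 + α = α * (k + 1 : ℕ) + 1 := fun k => by push_cast; ring
  have hs := summable_fracKernel_mul_norm hα₀ hα₁ T v ht
  rw [rlInt_congr α fun s hs _ => map_orbit_eq_tsum hα₀ hα₁ T v hs,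
    rlInt_tsum_fracKernel hα₀ (fun k => by positivity), orbit_eq_tsum α T v ht,
    Summable.tsum_eq_zero_add]
  · simp [h, fracKernel_one_of_pos ht]
  · refine Summable.of_norm_bounded hs fun k => ?_
    rw [norm_smul, Real.norm_of_nonneg (fracKernel_nonneg (by positivity) _)]
  · simp only [h]
    exact (summable_nat_add_iff 1).2 hs

/-- The only singularity of the derivative is the integrable factor `s ^ (α - 1)` at `0`; the
remaining series is continuous in `s`. -/
theorem norm_orbit_deriv_le {α : ℝ} (hα₀ : 0 < α) (hα₁ : α < 1) (T : E →L[ℝ] E) (v : E) (b : ℝ) :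
    ∃ C, ∀ s, 0 < s → s < b → ‖deriv (orbit α T v) s‖ ≤ C * fracKernel α s := by
  have hc : Continuous fun s : ℝ => series (derivCoeff (orbitCoeff α T v)) (s ^ α) :=
    (entireCoeff_orbitCoeff hα₀ hα₁ T v).derivCoeff.continuous.comp
      (Real.continuous_rpow_const hα₀.le)
  obtain ⟨C, hC⟩ := (isCompact_Icc (a := (0 : ℝ)) (b := b)).exists_bound_of_continuousOn
    hc.continuousOn
  refine ⟨C * α * Real.Gamma α, fun s h0 h1 => ?_⟩
  have hG := Real.Gamma_pos_of_pos hα₀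
  rw [(hasDerivAt_orbit hα₀ hα₁ T v h0).deriv, norm_smul, Real.norm_of_nonneg (by positivity),
    fracKernel_of_pos h0]
  have := hC s ⟨h0.le, h1.le⟩
  calc α * s ^ (α - 1) * ‖series (derivCoeff (orbitCoeff α T v)) (s ^ α)‖
      ≤ α * s ^ (α - 1) * C := by gcongr
    _ = _ := by field_simp

theorem eq_orbit_of_eq_add_rlInt {α : ℝ} (hα₀ : 0 < α) (hα₁ : α < 1) (T : E →L[ℝ] E) (v : E)
    {X : ℝ → E} {b : ℝ} (hX : ContinuousOn X (Icc 0 b))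
    (h : ∀ t, 0 < t → t ≤ b → X t = v + rlInt α (fun s => T (X s)) t) {t : ℝ} (h0 : 0 < t)
    (hb : t ≤ b) : X t = orbit α T v t := by
  have hY := (continuous_orbit hα₀ hα₁ T v)
  refine sub_eq_zero.1 (eq_zero_of_eq_rlInt hα₀ hα₁ T (W := fun t => X t - orbit α T v t)
    (hX.sub hY.continuousOn) (fun s h0 hb => ?_) h0 hb)
  simp only [h s h0 hb, orbit_eq_add_rlInt hα₀ hα₁ T v h0, add_sub_add_left_eq_sub, map_sub]
  rw [rlInt, rlInt, rlInt, ← integral_sub]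
  · simp only [smul_sub]
  · exact integrableOn_fracKernel_smul_of_continuousOn hα₀
      (T.continuous.comp_continuousOn (hX.mono (Icc_subset_Icc_right hb)))
  · exact integrableOn_fracKernel_smul_of_continuousOn hα₀ (T.continuous.comp hY).continuousOn

end Volterra

/-! ### Absolutely continuous curves in `ℝⁿ` -/

section AbsolutelyContinuous

theorem absolutelyContinuousOnInterval_of_dist_le {X Y : Type*} [PseudoMetricSpace X]
    [PseudoMetricSpace Y] {f : ℝ → X} {F : ℝ → Y} {a b : ℝ}
    (hF : AbsolutelyContinuousOnInterval F a b)
    (h : ∀ x ∈ uIcc a b, ∀ y ∈ uIcc a b, dist (f x) (f y) ≤ dist (F x) (F y)) :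
    AbsolutelyContinuousOnInterval f a b := by
  rw [absolutelyContinuousOnInterval_iff] at hF ⊢
  intro ε hε
  obtain ⟨δ, hδ, H⟩ := hF ε hε
  refine ⟨δ, hδ, fun D hD hlt => lt_of_le_of_lt (Finset.sum_le_sum fun i hi => ?_) (H D hD hlt)⟩
  exact h _ (hD.1 i hi).1 _ (hD.1 i hi).2

variable {n : ℕ} {f : ℝ → Fin n → ℝ} {a b : ℝ}

theorem absolutelyContinuousOnInterval_eval (hf : AbsolutelyContinuousOnInterval f a b)
    (i : Fin n) : AbsolutelyContinuousOnInterval (fun x => f x i) a b :=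
  absolutelyContinuousOnInterval_of_dist_le hf fun x _ y _ => dist_le_pi_dist (f x) (f y) i

theorem ae_deriv_eval (hf : AbsolutelyContinuousOnInterval f a b) :
    ∀ᵐ x, x ∈ uIcc a b → ∀ i, deriv (fun x => f x i) x = deriv f x i := by
  have h : ∀ᵐ x, ∀ i, x ∈ uIcc a b → DifferentiableAt ℝ (fun x => f x i) x :=
    ae_all_iff.2 fun i => (absolutelyContinuousOnInterval_eval hf i).ae_differentiableAt
  filter_upwards [h] with x hx hxm i
  rw [deriv_pi fun i => hx i hxm]

theorem intervalIntegrable_deriv_pi (hf : AbsolutelyContinuousOnInterval f a b) :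
    IntervalIntegrable (deriv f) volume a b := by
  rw [intervalIntegrable_iff]
  refine Integrable.of_eval fun i => ?_
  have h := (absolutelyContinuousOnInterval_eval hf i).intervalIntegrable_deriv
  rw [intervalIntegrable_iff] at h
  refine h.congr ?_
  filter_upwards [ae_restrict_of_ae (ae_deriv_eval hf), ae_restrict_mem measurableSet_uIoc]
    with x hx hxm
  exact hx (uIoc_subset_uIcc hxm) i

theorem integral_deriv_pi_eq_sub (hab : a ≤ b) (hf : AbsolutelyContinuousOnInterval f a b) :
    ∫ x in a..b, deriv f x = f b - f a := by
  have hint := intervalIntegrable_deriv_pi hf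
  ext i
  rw [Pi.sub_apply, ← (absolutelyContinuousOnInterval_eval hf i).integral_deriv_eq_sub,
    intervalIntegral.integral_of_le hab, intervalIntegral.integral_of_le hab, eval_integral]
  · refine setIntegral_congr_ae measurableSet_Ioc ?_
    filter_upwards [ae_deriv_eval hf] with x hx hxm
    rw [hx (uIcc_of_le hab ▸ Ioc_subset_Icc_self hxm)]
  · exact fun i => ((intervalIntegrable_iff_integrableOn_Ioc_of_le hab).1 hint).eval i

end AbsolutelyContinuous

/-! ### The Caputo initial value problem -/

section Solution

variable {n : ℕ}

/-- The continuous linear map `x ↦ A x` on `ℝⁿ`. -/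
def matrixCLM (A : Matrix (Fin n) (Fin n) ℝ) : (Fin n → ℝ) →L[ℝ] (Fin n → ℝ) :=
  LinearMap.toContinuousLinearMap A.mulVecLin

@[simp] theorem matrixCLM_apply (A : Matrix (Fin n) (Fin n) ℝ) (v : Fin n → ℝ) :
    matrixCLM A v = A.mulVec v := rfl

theorem matrixCLM_pow_apply (A : Matrix (Fin n) (Fin n) ℝ) (k : ℕ) (v : Fin n → ℝ) :
    (matrixCLM A ^ k) v = (A ^ k).mulVec v := by
  induction k generalizing v with
  | zero => simp
  | succ k ih => rw [pow_succ, pow_succ, mul_apply_eq_comp, ih, matrixCLM_apply, Matrix.mulVec_mulVec]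

open scoped Matrix.Norms.Operator in
theorem summable_mittagLeffler_matrix {α : ℝ} (hα₀ : 0 < α) (hα₁ : α < 1)
    (M : Matrix (Fin n) (Fin n) ℝ) :
    Summable fun k : ℕ => (Real.Gamma (α * k + 1))⁻¹ • M ^ k := by
  refine Summable.of_norm_bounded_eventually_nat (summable_pow_mul_mlCoeff hα₀ hα₁ ‖M‖) ?_
  filter_upwards [eventually_gt_atTop 0] with k hk
  have h := mlCoeff_pos hα₀ k
  rw [← mlCoeff, norm_smul, Real.norm_of_nonneg h.le, mul_comm]
  gcongr
  exact norm_pow_le' M hk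

theorem mittagLeffler_mulVec {α : ℝ} (hα₀ : 0 < α) (hα₁ : α < 1) (A : Matrix (Fin n) (Fin n) ℝ)
    (v : Fin n → ℝ) (x : ℝ) :
    (mittagLeffler α (x • A)).mulVec v = series (orbitCoeff α (matrixCLM A) v) x := by
  let L : Matrix (Fin n) (Fin n) ℝ →ₗ[ℝ] (Fin n → ℝ) := (Matrix.mulVecBilin ℝ ℝ).flip v
  have hL : Continuous L := by
    change Continuous fun M : Matrix (Fin n) (Fin n) ℝ => M.mulVec v
    fun_prop
  have h := (⟨L, hL⟩ : Matrix (Fin n) (Fin n) ℝ →L[ℝ] (Fin n → ℝ)).map_tsum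
    (summable_mittagLeffler_matrix hα₀ hα₁ (x • A))
  change (mittagLeffler α (x • A)).mulVec v = _ at h
  rw [h, series]
  refine tsum_congr fun k => ?_
  change ((Real.Gamma (α * k + 1))⁻¹ • (x • A) ^ k).mulVec v = _
  rw [orbitCoeff, matrixCLM_pow_apply, smul_pow, Matrix.smul_mulVec, Matrix.smul_mulVec, mlCoeff,
    smul_comm]

theorem caputoIntegrand_eq_fracKernel {α : ℝ} (hα₁ : α < 1) (f : ℝ → Fin n → ℝ) {t s : ℝ}
    (hs : s < t) :
    caputoIntegrand α f t s = Real.Gamma (1 - α) • fracKernel (1 - α) (t - s) • deriv f s := by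
  have := Real.Gamma_pos_of_pos (sub_pos.2 hα₁)
  rw [caputoIntegrand, fracKernel_of_pos (sub_pos.2 hs), smul_smul,
    show 1 - α - 1 = -α by ring]
  congr 1
  field_simp

theorem caputoDeriv_eq_rlInt {α : ℝ} (hα₁ : α < 1) (f : ℝ → Fin n → ℝ) {t : ℝ} (ht : 0 ≤ t) :
    caputoDeriv α f t = rlInt (1 - α) (deriv f) t := by
  have := Real.Gamma_pos_of_pos (sub_pos.2 hα₁)
  rw [caputoDeriv, rlInt_eq_intervalIntegral _ _ ht, intervalIntegral.integral_of_le ht,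
    intervalIntegral.integral_of_le ht, integral_Ioc_eq_integral_Ioo,
    integral_Ioc_eq_integral_Ioo, setIntegral_congr_fun measurableSet_Ioo
      fun s hs => caputoIntegrand_eq_fracKernel hα₁ f hs.2, integral_smul, smul_smul,
    inv_mul_cancel₀ this.ne', one_smul]

/-- Absolute continuity gives `X = X₀ + I^1 X'`; splitting `I^1 = I^α I^(1-α)` and inserting the
Caputo equation yields the Volterra equation, which has only one continuous solution. -/
theorem IsSolution.eq_orbit {α : ℝ} (hα₀ : 0 < α) (hα₁ : α < 1) {A : Matrix (Fin n) (Fin n) ℝ}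
    {X₀ : Fin n → ℝ} {X : ℝ → Fin n → ℝ} (h : IsSolution α A X₀ X) {t : ℝ} (ht : 0 ≤ t) :
    X t = orbit α (matrixCLM A) X₀ t := by
  rcases ht.eq_or_lt with rfl | ht
  · rw [h.initial, orbit_zero hα₀]
  have hcont := (h.absolutelyContinuous t ht).continuousOn
  rw [uIcc_of_le ht.le] at hcont
  refine eq_orbit_of_eq_add_rlInt hα₀ hα₁ (matrixCLM A) X₀ hcont (fun s h0 _ => ?_) ht le_rfl
  have hac := h.absolutelyContinuous s h0
  have hint := (intervalIntegrable_iff_integrableOn_Ioc_of_le h0.le).1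
    (intervalIntegrable_deriv_pi hac)
  have hX : X s = X₀ + rlInt 1 (deriv X) s := by
    rw [rlInt_eq_intervalIntegral _ _ h0.le, ← sub_eq_iff_eq_add', ← h.initial,
      ← integral_deriv_pi_eq_sub h0.le hac, intervalIntegral.integral_of_le h0.le,
      intervalIntegral.integral_of_le h0.le, integral_Ioc_eq_integral_Ioo,
      integral_Ioc_eq_integral_Ioo]
    refine setIntegral_congr_fun measurableSet_Ioo fun r hr => ?_
    simp only [fracKernel_one_of_pos (sub_pos.2 hr.2), one_smul]
  have hsemi := rlInt_rlInt (a := α) (b := 1 - α) (t := s) hα₀ (sub_pos.2 hα₁)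
    (aestronglyMeasurable_deriv X (volume.restrict (Ioi 0))) (by
      rw [add_sub_cancel]
      have h1 : IntegrableOn (fun r => fracKernel 1 (s - r) • deriv X r) (Ioo 0 s) := by
        refine (hint.mono_set Ioo_subset_Ioc_self).congr_fun (fun r hr => ?_) measurableSet_Ioo
        simp only [fracKernel_one_of_pos (sub_pos.2 hr.2), one_smul]
      refine h1.of_forall_sdiff_eq_zero measurableSet_Ioi ?_
      rintro r ⟨hr, hr'⟩
      rw [fracKernel_of_nonpos (sub_nonpos.2 (not_lt.1 fun h => hr' ⟨hr, h⟩)), zero_smul])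
  rw [add_sub_cancel] at hsemi
  rw [hX, ← hsemi]
  congr 1
  refine rlInt_congr α fun r hr _ => ?_
  rw [← caputoDeriv_eq_rlInt hα₁ X hr.le, h.equation r hr, matrixCLM_apply]

theorem isSolution_of_eq_orbit {α : ℝ} (hα₀ : 0 < α) (hα₁ : α < 1)
    {A : Matrix (Fin n) (Fin n) ℝ} {X₀ : Fin n → ℝ} {X : ℝ → Fin n → ℝ}
    (h : ∀ t, 0 ≤ t → X t = orbit α (matrixCLM A) X₀ t) : IsSolution α A X₀ X := by
  set Y := orbit α (matrixCLM A) X₀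
  -- Only `s > 0` is possible: `X` is arbitrary on negative times.
  have hder : ∀ s, 0 < s → deriv X s = deriv Y s := fun s hs =>
    Filter.EventuallyEq.deriv_eq (by
      filter_upwards [Ioi_mem_nhds hs] with r hr using h r (le_of_lt hr))
  have hY : Continuous Y := continuous_orbit hα₀ hα₁ _ _
  have hdiff : ∀ s, 0 < s → HasDerivAt Y (deriv Y s) s := fun s hs =>
    (hasDerivAt_orbit hα₀ hα₁ (matrixCLM A) X₀ hs).differentiableAt.hasDerivAt
  have hmeas : StronglyMeasurable (deriv Y) := stronglyMeasurable_deriv Y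
  refine ⟨fun b hb => ?_, ?_, fun t ht => ?_, fun t ht => ?_⟩
  · obtain ⟨C, hC⟩ := norm_orbit_deriv_le hα₀ hα₁ (matrixCLM A) X₀ b
    have hint : IntervalIntegrable (deriv Y) volume 0 b := by
      rw [intervalIntegrable_iff_integrableOn_Ioo_of_le hb.le]
      have h1 := (integrableOn_fracKernel_smul (t := b) one_pos hα₀
        hmeas.aestronglyMeasurable hC).mono_set (Ioo_subset_Ioi_self : Ioo 0 b ⊆ _)
      refine h1.congr_fun (fun r hr => ?_) measurableSet_Ioo
      simp only [fracKernel_one_of_pos (sub_pos.2 hr.2), one_smul]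
    have hsub : ∀ x ∈ uIcc 0 b, ∀ y ∈ uIcc 0 b, IntervalIntegrable (deriv Y) volume x y :=
      fun x hx y hy => hint.mono_set (uIcc_subset_uIcc hx hy)
    have hle : ∀ x ∈ uIcc 0 b, ∀ y ∈ uIcc 0 b, x ≤ y → ∫ r in x..y, deriv Y r = Y y - Y x := by
      intro x hx y hy hxy
      refine intervalIntegral.integral_eq_sub_of_hasDerivAt_of_le hxy hY.continuousOn
        (fun r hr => hdiff r ?_) (hsub x hx y hy)
      rw [uIcc_of_le hb.le] at hx
      exact hx.1.trans_lt hr.1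
    -- Increments of `X` are dominated by those of the primitive of `‖Y'‖`, which is absolutely
    -- continuous.
    refine absolutelyContinuousOnInterval_of_dist_le
      (hint.norm.absolutelyContinuousOnInterval_intervalIntegral left_mem_uIcc)
      fun x hx y hy => ?_
    wlog hxy : x ≤ y generalizing x y
    · rw [dist_comm, dist_comm (∫ r in (0 : ℝ)..x, ‖deriv Y r‖)]
      exact this y hy x hx (le_of_not_ge hxy)
    have h0 : ∀ z ∈ uIcc 0 b, 0 ≤ z := fun z hz => (uIcc_of_le hb.le ▸ hz).1
    rw [h x (h0 x hx), h y (h0 y hy), dist_comm, dist_comm (∫ r in (0 : ℝ)..x, ‖deriv Y r‖),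
      dist_eq_norm, dist_eq_norm, ← hle x hx y hy hxy, intervalIntegral.integral_interval_sub_left
        (hsub 0 left_mem_uIcc y hy).norm (hsub 0 left_mem_uIcc x hx).norm]
    exact intervalIntegral.norm_integral_le_abs_integral_norm
  · rw [h 0 le_rfl]
    exact orbit_zero hα₀ _ _
  · obtain ⟨C, hC⟩ := norm_orbit_deriv_le hα₀ hα₁ (matrixCLM A) X₀ t
    rw [intervalIntegrable_iff_integrableOn_Ioo_of_le ht.le]
    have h1 := ((integrableOn_fracKernel_smul (a := 1 - α) (t := t) (sub_pos.2 hα₁) hα₀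
      hmeas.aestronglyMeasurable hC).mono_set (Ioo_subset_Ioi_self : Ioo 0 t ⊆ _)).smul
      (Real.Gamma (1 - α))
    refine IntegrableOn.congr_fun h1 (fun r hr => ?_) measurableSet_Ioo
    rw [caputoIntegrand_eq_fracKernel hα₁ X hr.2, hder r hr.1]
    rfl
  · rw [caputoDeriv_eq_rlInt hα₁ X ht.le, rlInt_congr (1 - α) fun s hs _ => hder s hs,
      rlInt_deriv_orbit hα₀ hα₁ (matrixCLM A) X₀ ht, h t ht.le, matrixCLM_apply]

end Solution

/-! ### The scalar function `E_α(c t^α)`: positivity and range -/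

/-- This is `(t - s)/(t₀ - s) ≤ t/t₀` raised to the power `1 - α`. The factor is below `1` uniformly
in `s`, which drives the positivity argument. -/
theorem fracKernel_le_mul {α s t t₀ : ℝ} (hα₀ : 0 < α) (hα₁ : α < 1) (hs : 0 < s) (hst : s < t)
    (ht : t < t₀) :
    fracKernel α (t₀ - s) ≤ (t / t₀) ^ (1 - α) * fracKernel α (t - s) := by
  have hG := Real.Gamma_pos_of_pos hα₀
  have h1 : 0 < t - s := sub_pos.2 hst
  have h2 : 0 < t₀ - s := by linarith
  have h3 : 0 < t := hs.trans hst
  have h4 : 0 < t₀ := h3.trans ht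
  rw [fracKernel_of_pos h1, fracKernel_of_pos h2, ← mul_div_assoc]
  refine div_le_div_of_nonneg_right ?_ hG.le
  rw [show α - 1 = -(1 - α) by ring, Real.rpow_neg h1.le, Real.rpow_neg h2.le, ← div_eq_mul_inv,
    ← Real.div_rpow (by positivity) h1.le, ← Real.inv_rpow h2.le]
  refine Real.rpow_le_rpow (by positivity) ?_ (by linarith)
  rw [div_div, inv_eq_one_div, div_le_div_iff₀ h2 (by positivity)]
  nlinarith

/-- At a first zero `t₀`, the integral is at least `1/lam`, while at `r = t₀ - h` it is at most
`1/lam`. Kernel decay from `r` to `t₀` loses an amount of order `h`, but the new piece `[r, t₀]`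
contributes only `O(h^(1+α))` because `u` is small near its zero. Letting `h → 0` is contradictory.
-/
theorem pos_of_eq_one_sub_rlInt {α lam : ℝ} (hα₀ : 0 < α) (hα₁ : α < 1) (hlam : 0 < lam)
    {u : ℝ → ℝ} (hc : Continuous u) (hd : ∀ t, 0 < t → DifferentiableAt ℝ u t) (h0 : 0 < u 0)
    (hu : ∀ t, 0 < t → u t = 1 - lam * rlInt α u t) {t : ℝ} (ht : 0 ≤ t) : 0 < u t := by
  by_contra hneg
  obtain ⟨t₀, ⟨⟨ht₀, -⟩, hut₀⟩, hmin⟩ : ∃ t₀, IsLeast {s | s ∈ Icc 0 t ∧ u s ≤ 0} t₀ :=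
    ((isCompact_Icc (a := (0 : ℝ)) (b := t)).inter_right
      (isClosed_le hc continuous_const)).exists_isLeast ⟨t, ⟨ht, le_rfl⟩, not_lt.1 hneg⟩
  have hpos : ∀ s, 0 ≤ s → s < t₀ → 0 < u s := by
    intro s hs hst
    by_contra h
    have htt : t₀ ≤ t := hmin ⟨⟨ht, le_rfl⟩, not_lt.1 hneg⟩
    exact absurd (hmin ⟨⟨hs, by linarith⟩, not_lt.1 h⟩) (not_le.2 hst)
  have ht₀' : 0 < t₀ := by
    rcases ht₀.eq_or_lt with h | h
    · rw [← h] at hut₀; linarith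
    · exact h
  have hG := Real.Gamma_pos_of_pos hα₀
  -- Differentiability at `t₀` together with `u t₀ ≤ 0` gives `u s ≤ K (t₀ - s)` just before `t₀`.
  obtain ⟨K, hK, hbound⟩ := (hd t₀ ht₀').hasDerivAt.isBigO_sub.exists_pos
  obtain ⟨δ, hδ, hball⟩ := Metric.eventually_nhds_iff.1 hbound.bound
  have hint : ∀ r, IntegrableOn (fun s => fracKernel α (r - s) • u s) (Ioi 0) := fun r =>
    integrableOn_fracKernel_smul_of_continuousOn hα₀ hc.continuousOn
  have key : ∀ h, 0 < h → h < δ → h < t₀ →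
      (1 - α) / (lam * t₀) ≤ K / Real.Gamma α * h ^ α := by
    intro h hh hhδ hht
    set r := t₀ - h with hr
    have hr0 : 0 < r := sub_pos.2 hht
    have hrt : r < t₀ := by linarith
    set B := K * h ^ α / Real.Gamma α with hB
    have hB0 : 0 ≤ B := by positivity
    have hpt : ∀ s ∈ Ioi (0 : ℝ), fracKernel α (t₀ - s) • u s ≤
        (r / t₀) ^ (1 - α) * (fracKernel α (r - s) • u s) + (Ico r t₀).indicator (fun _ => B) s := by
      intro s hs
      have hs0 : 0 < s := hs
      rcases lt_or_ge s r with hsr | hsr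
      · rw [indicator_of_notMem (fun h => not_le.2 hsr h.1), add_zero, smul_eq_mul, smul_eq_mul,
          ← mul_assoc]
        exact mul_le_mul_of_nonneg_right (fracKernel_le_mul hα₀ hα₁ hs0 hsr hrt)
          (hpos s hs0.le (hsr.trans hrt)).le
      · rw [fracKernel_of_nonpos (sub_nonpos.2 hsr), zero_smul, mul_zero, zero_add]
        rcases lt_or_ge s t₀ with hst | hst
        · rw [indicator_of_mem (mem_Ico.2 ⟨hsr, hst⟩)]
          have hd0 : 0 < t₀ - s := sub_pos.2 hst
          have hdh : t₀ - s ≤ h := by linarith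
          have h1 := hball (y := s) (by
            rw [Real.dist_eq, abs_sub_comm, abs_of_pos hd0]; linarith)
          rw [Real.norm_eq_abs, Real.norm_eq_abs, abs_sub_comm s, abs_of_pos hd0] at h1
          have h2 : u s ≤ K * (t₀ - s) := by linarith [le_abs_self (u s - u t₀)]
          calc fracKernel α (t₀ - s) • u s ≤ fracKernel α (t₀ - s) * (K * (t₀ - s)) :=
                mul_le_mul_of_nonneg_left h2 (fracKernel_nonneg hα₀ _)
            _ = K * (t₀ - s) ^ α / Real.Gamma α := by
                rw [fracKernel_of_pos hd0, Real.rpow_sub_one hd0.ne']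
                field_simp
            _ ≤ B := by
                rw [hB]
                gcongr
        · rw [fracKernel_of_nonpos (sub_nonpos.2 hst), zero_smul]
          exact indicator_nonneg (fun _ _ => hB0) _
    have hindint : IntegrableOn ((Ico r t₀).indicator (fun _ => B)) (Ioi 0) := by
      refine Integrable.integrableOn ?_
      rw [integrable_indicator_iff measurableSet_Ico]
      exact integrableOn_const (by simp)
    have hle := setIntegral_mono_on (hint t₀) (((hint r).const_mul _).add hindint)
      measurableSet_Ioi hpt
    have hind : ∫ s in Ioi 0, (Ico r t₀).indicator (fun _ => B) s = B * h := by
      rw [setIntegral_indicator measurableSet_Ico, inter_eq_self_of_subset_right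
        (show Ico r t₀ ⊆ Ioi 0 from fun s hs => hr0.trans_le hs.1), setIntegral_const, Real.volume_real_Ico_of_le hrt.le,
        smul_eq_mul, hr]
      ring
    simp only [Pi.add_apply] at hle
    rw [integral_add ((hint r).const_mul _) hindint, integral_const_mul, hind] at hle
    change rlInt α u t₀ ≤ (r / t₀) ^ (1 - α) * rlInt α u r + B * h at hle
    have e1 : 1 / lam ≤ rlInt α u t₀ := by
      rw [div_le_iff₀ hlam]
      linarith [hu t₀ ht₀']
    have e2 : rlInt α u r ≤ 1 / lam := by
      rw [le_div_iff₀ hlam]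
      linarith [hu r hr0, hpos r hr0.le hrt]
    -- Bernoulli's inequality for an exponent in `[0, 1]`, where the power is concave.
    have hq : (r / t₀) ^ (1 - α) ≤ 1 - (1 - α) * (h / t₀) := by
      have := rpow_one_add_le_one_add_mul_self (s := -(h / t₀)) (p := 1 - α)
        (by rw [neg_le_neg_iff, div_le_one ht₀']; exact hht.le) (by linarith) (by linarith)
      rw [show r / t₀ = 1 + -(h / t₀) by rw [hr]; field_simp; ring]
      linarith
    have hq0 : 0 ≤ (r / t₀) ^ (1 - α) := by positivity
    have e3 : 1 / lam ≤ (1 - (1 - α) * (h / t₀)) * (1 / lam) + B * h := by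
      calc 1 / lam ≤ (r / t₀) ^ (1 - α) * rlInt α u r + B * h := e1.trans hle
        _ ≤ (r / t₀) ^ (1 - α) * (1 / lam) + B * h := by gcongr
        _ ≤ _ := by gcongr
    have e4 : (1 - α) / (lam * t₀) * h ≤ K / Real.Gamma α * h ^ α * h := by
      have : (1 - α) / (lam * t₀) * h = 1 / lam - (1 - (1 - α) * (h / t₀)) * (1 / lam) := by
        field_simp
        ring
      rw [this, show K / Real.Gamma α * h ^ α * h = B * h by rw [hB]; ring]
      linarith
    exact le_of_mul_le_mul_right e4 hh
  have hlim : Tendsto (fun h : ℝ => K / Real.Gamma α * h ^ α) (𝓝[>] 0) (𝓝 0) := by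
    have : Tendsto (fun h : ℝ => K / Real.Gamma α * h ^ α) (𝓝 0)
        (𝓝 (K / Real.Gamma α * 0 ^ α)) :=
      ((Real.continuous_rpow_const hα₀.le).tendsto 0).const_mul _
    rw [Real.zero_rpow hα₀.ne', mul_zero] at this
    exact this.mono_left nhdsWithin_le_nhds
  have hfin : (1 - α) / (lam * t₀) ≤ 0 := by
    refine ge_of_tendsto hlim ?_
    filter_upwards [Ioo_mem_nhdsGT (lt_min hδ ht₀')] with h hh
    exact key h hh.1 (hh.2.trans_le (min_le_left _ _)) (hh.2.trans_le (min_le_right _ _))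
  have : 0 < (1 - α) / (lam * t₀) := div_pos (sub_pos.2 hα₁) (by positivity)
  linarith

theorem rlInt_one {α : ℝ} (hα₀ : 0 < α) {t : ℝ} (ht : 0 < t) :
    rlInt α (fun _ => (1 : ℝ)) t = t ^ α / Real.Gamma (α + 1) := by
  have h := integral_fracKernel_mul hα₀ one_pos t
  rw [← setIntegral_eq_integral_of_forall_compl_eq_zero (s := Ioi 0), fracKernel_of_pos ht,
    add_sub_cancel_right] at h
  · rw [← h, rlInt]
    refine setIntegral_congr_fun measurableSet_Ioi fun s hs => ?_
    simp only [fracKernel_one_of_pos hs, smul_eq_mul]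
  · intro s hs
    rw [fracKernel_of_nonpos (not_lt.1 hs), mul_zero]

/-- The real function `t ↦ E_α(c t ^ α)`. -/
def scalarOrbit (α c : ℝ) (t : ℝ) : ℝ := mittagLeffler α (c * t ^ α)

theorem scalarOrbit_eq_orbit (α c : ℝ) :
    scalarOrbit α c = orbit α (c • (1 : ℝ →L[ℝ] ℝ)) (1 : ℝ) := by
  ext t
  rw [scalarOrbit, mittagLeffler, orbit, series]
  refine tsum_congr fun k => ?_
  rw [orbitCoeff, smul_pow, one_pow, mlCoeff, mul_pow]
  simp only [smul_eq_mul, smul_apply, one_apply_eq_self]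
  ring

theorem continuous_scalarOrbit {α : ℝ} (hα₀ : 0 < α) (hα₁ : α < 1) (c : ℝ) :
    Continuous (scalarOrbit α c) := by
  rw [scalarOrbit_eq_orbit]
  exact continuous_orbit hα₀ hα₁ _ _

theorem scalarOrbit_zero {α : ℝ} (hα₀ : 0 < α) (c : ℝ) : scalarOrbit α c 0 = 1 := by
  rw [scalarOrbit_eq_orbit, orbit_zero hα₀]

theorem scalarOrbit_eq_one_add {α : ℝ} (hα₀ : 0 < α) (hα₁ : α < 1) (c : ℝ) {t : ℝ} (ht : 0 < t) :
    scalarOrbit α c t = 1 + c * rlInt α (scalarOrbit α c) t := by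
  rw [scalarOrbit_eq_orbit, orbit_eq_add_rlInt hα₀ hα₁ _ _ ht, rlInt, rlInt, ← smul_eq_mul c,
    ← integral_smul]
  congr 2
  ext s
  simp only [smul_eq_mul, smul_apply, one_apply_eq_self]
  ring

theorem scalarOrbit_pos {α : ℝ} (hα₀ : 0 < α) (hα₁ : α < 1) {c : ℝ} (hc : c < 0) {t : ℝ}
    (ht : 0 ≤ t) : 0 < scalarOrbit α c t := by
  refine pos_of_eq_one_sub_rlInt hα₀ hα₁ (neg_pos.2 hc) (continuous_scalarOrbit hα₀ hα₁ c)
    (fun t ht => ?_) ?_ (fun t ht => ?_) ht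
  · rw [scalarOrbit_eq_orbit]
    exact (hasDerivAt_orbit hα₀ hα₁ _ _ ht).differentiableAt
  · rw [scalarOrbit_zero hα₀]
    exact one_pos
  · rw [scalarOrbit_eq_one_add hα₀ hα₁ c ht]
    ring

theorem scalarOrbit_le_one {α : ℝ} (hα₀ : 0 < α) (hα₁ : α < 1) {c : ℝ} (hc : c < 0) {t : ℝ}
    (ht : 0 ≤ t) : scalarOrbit α c t ≤ 1 := by
  rcases ht.eq_or_lt with rfl | ht
  · rw [scalarOrbit_zero hα₀]
  rw [scalarOrbit_eq_one_add hα₀ hα₁ c ht]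
  have : 0 ≤ rlInt α (scalarOrbit α c) t := setIntegral_nonneg measurableSet_Ioi fun s hs =>
    mul_nonneg (fracKernel_nonneg hα₀ _) (scalarOrbit_pos hα₀ hα₁ hc (le_of_lt hs)).le
  nlinarith

/-- A lower bound `ε` would make the fractional integral grow at least like `t ^ α`, and the
Volterra equation would force a negative value. -/
theorem exists_scalarOrbit_lt {α : ℝ} (hα₀ : 0 < α) (hα₁ : α < 1) {c : ℝ} (hc : c < 0) {ε : ℝ}
    (hε : 0 < ε) : ∃ t, 0 ≤ t ∧ scalarOrbit α c t < ε := by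
  by_contra! hcon
  have hG : 0 < Real.Gamma (α + 1) := Real.Gamma_pos_of_pos (by positivity)
  have hbd : ∀ t, 0 < t → -c * ε / Real.Gamma (α + 1) * t ^ α ≤ 1 := by
    intro t ht
    have h1 : rlInt α (fun _ => ε) t ≤ rlInt α (scalarOrbit α c) t :=
      setIntegral_mono_on
        (integrableOn_fracKernel_smul_of_continuousOn hα₀ continuous_const.continuousOn)
        (integrableOn_fracKernel_smul_of_continuousOn hα₀
          (continuous_scalarOrbit hα₀ hα₁ c).continuousOn) measurableSet_Ioi fun s hs =>
        mul_le_mul_of_nonneg_left (hcon s (le_of_lt hs)) (fracKernel_nonneg hα₀ _)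
    have h2 : rlInt α (fun _ => ε) t = ε * (t ^ α / Real.Gamma (α + 1)) := by
      rw [← rlInt_one hα₀ ht, rlInt, rlInt, ← integral_const_mul]
      congr 1
      ext s
      simp only [smul_eq_mul]
      ring
    have h3 := scalarOrbit_eq_one_add hα₀ hα₁ c ht
    have h4 := scalarOrbit_pos hα₀ hα₁ hc ht.le
    rw [h2] at h1
    have h5 := mul_le_mul_of_nonneg_left h1 (neg_pos.2 hc).le
    calc _ = -c * (ε * (t ^ α / Real.Gamma (α + 1))) := by ring
      _ ≤ 1 := by linarith
  have hpos : 0 < -c * ε / Real.Gamma (α + 1) := by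
    have := neg_pos.2 hc
    positivity
  have hlim := (tendsto_rpow_atTop hα₀).const_mul_atTop hpos
  obtain ⟨t, ht1, ht2⟩ := ((hlim.eventually_gt_atTop 1).and (eventually_gt_atTop 0)).exists
  linarith [hbd t ht2]

theorem one_add_le_scalarOrbit {α : ℝ} (hα₀ : 0 < α) (hα₁ : α < 1) {c : ℝ} (hc : 0 ≤ c) {t : ℝ}
    (ht : 0 ≤ t) : 1 + mlCoeff α 1 * (c * t ^ α) ≤ scalarOrbit α c t := by
  have hx : 0 ≤ c * t ^ α := by positivity
  have hs : Summable fun k : ℕ => mlCoeff α k • (c * t ^ α) ^ k :=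
    (summable_pow_mul_mlCoeff hα₀ hα₁ (c * t ^ α)).congr fun k => mul_comm _ _
  have h := hs.sum_le_tsum (Finset.range 2) fun k _ =>
    mul_nonneg (mlCoeff_pos hα₀ k).le (pow_nonneg hx k)
  simpa [Finset.sum_range_succ, scalarOrbit, mittagLeffler, mlCoeff] using h

/-- The product lies between the value `1` at time `0` and a value attained later, so the
intermediate value theorem applies. -/
theorem exists_scalarOrbit_eq_mul {α : ℝ} (hα₀ : 0 < α) (hα₁ : α < 1) (c : ℝ) {s t : ℝ}
    (hs : 0 ≤ s) (ht : 0 ≤ t) :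
    ∃ r, 0 ≤ r ∧ scalarOrbit α c r = scalarOrbit α c s * scalarOrbit α c t := by
  have hcont := continuous_scalarOrbit hα₀ hα₁ c
  rcases lt_trichotomy c 0 with hc | rfl | hc
  · have hs0 := scalarOrbit_pos hα₀ hα₁ hc hs
    have ht0 := scalarOrbit_pos hα₀ hα₁ hc ht
    have hle : scalarOrbit α c s * scalarOrbit α c t ≤ 1 :=
      mul_le_one₀ (scalarOrbit_le_one hα₀ hα₁ hc hs) ht0.le (scalarOrbit_le_one hα₀ hα₁ hc ht)
    obtain ⟨b, hb, hlt⟩ := exists_scalarOrbit_lt hα₀ hα₁ hc (mul_pos hs0 ht0)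
    obtain ⟨r, hr, hr'⟩ := intermediate_value_Icc' hb hcont.continuousOn
      ⟨hlt.le, by rwa [scalarOrbit_zero hα₀]⟩
    exact ⟨r, hr.1, hr'⟩
  · have h1 : ∀ t, scalarOrbit α 0 t = 1 := fun t => by
      rw [← scalarOrbit_zero hα₀ 0, scalarOrbit, scalarOrbit, zero_mul, zero_mul]
    exact ⟨0, le_rfl, by simp [h1]⟩
  · have hpos : 0 < mlCoeff α 1 * c := mul_pos (mlCoeff_pos hα₀ 1) hc
    have hge : ∀ t, 0 ≤ t → 1 ≤ scalarOrbit α c t := fun t ht => by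
      have h1 := one_add_le_scalarOrbit hα₀ hα₁ hc.le ht
      have h2 : 0 ≤ mlCoeff α 1 * (c * t ^ α) := by
        rw [← mul_assoc]
        positivity
      linarith
    set y := scalarOrbit α c s * scalarOrbit α c t
    have hy : 1 ≤ y := one_le_mul_of_one_le_of_one_le (hge s hs) (hge t ht)
    have hlim := (tendsto_rpow_atTop hα₀).const_mul_atTop hpos
    obtain ⟨b, hb1, hb⟩ := ((hlim.eventually_ge_atTop y).and (eventually_ge_atTop 0)).exists
    obtain ⟨r, hr, hr'⟩ := intermediate_value_Icc hb hcont.continuousOn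
      (show y ∈ _ from ⟨by rwa [scalarOrbit_zero hα₀], by
        have := one_add_le_scalarOrbit hα₀ hα₁ hc.le hb
        rw [← mul_assoc] at this
        linarith⟩)
    exact ⟨r, hr.1, hr'⟩

/-! ### Invariance on eigenvectors -/

section Eigenvector

variable {n : ℕ}

theorem flow_eq_orbit {α : ℝ} (hα₀ : 0 < α) (hα₁ : α < 1) (A : Matrix (Fin n) (Fin n) ℝ) (t : ℝ)
    (x : Fin n → ℝ) : flow α A t x = orbit α (matrixCLM A) x t :=
  mittagLeffler_mulVec hα₀ hα₁ A x (t ^ α)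

theorem flow_smul (α : ℝ) (A : Matrix (Fin n) (Fin n) ℝ) (t a : ℝ) (x : Fin n → ℝ) :
    flow α A t (a • x) = a • flow α A t x :=
  Matrix.mulVec_smul _ _ _

theorem flow_of_mulVec_eq_smul {α : ℝ} (hα₀ : 0 < α) (hα₁ : α < 1) {A : Matrix (Fin n) (Fin n) ℝ}
    {x : Fin n → ℝ} {c : ℝ} (h : A.mulVec x = c • x) (t : ℝ) :
    flow α A t x = scalarOrbit α c t • x := by
  have hpow : ∀ k : ℕ, (matrixCLM A ^ k) x = c ^ k • x := by
    intro k
    induction k with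
    | zero => simp
    | succ k ih =>
      rw [pow_succ', mul_apply_eq_comp, ih, map_smul, matrixCLM_apply, h, smul_smul, pow_succ]
  have hs : Summable fun k : ℕ => mlCoeff α k • (c * t ^ α) ^ k :=
    (summable_pow_mul_mlCoeff hα₀ hα₁ (c * t ^ α)).congr fun k => mul_comm _ _
  rw [flow_eq_orbit hα₀ hα₁, orbit, series, scalarOrbit, mittagLeffler]
  refine Eq.trans (tsum_congr fun k => ?_) (hs.tsum_smul_const x)
  rw [orbitCoeff, hpow, smul_smul, smul_smul, mul_pow, smul_eq_mul]
  congr 1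
  ring

theorem isInvariant_solutionCurve_of_mulVec_eq_smul {α : ℝ} (hα₀ : 0 < α) (hα₁ : α < 1)
    {A : Matrix (Fin n) (Fin n) ℝ} {x : Fin n → ℝ} {c : ℝ} (h : A.mulVec x = c • x) :
    IsInvariant α A (solutionCurve α A x) := by
  rintro s hs _ ⟨_, ⟨t, ht, rfl⟩, rfl⟩
  obtain ⟨r, hr, hr'⟩ := exists_scalarOrbit_eq_mul hα₀ hα₁ c ht hs
  refine ⟨r, hr, ?_⟩
  simp only [flow_of_mulVec_eq_smul hα₀ hα₁ h, flow_smul, hr', smul_smul]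

theorem isInvariant_span_of_mulVec_eq_smul {α : ℝ} (hα₀ : 0 < α) (hα₁ : α < 1)
    {A : Matrix (Fin n) (Fin n) ℝ} {x : Fin n → ℝ} {c : ℝ} (h : A.mulVec x = c • x) :
    IsInvariant α A (Submodule.span ℝ {x} : Set (Fin n → ℝ)) := by
  rintro s hs _ ⟨y, hy, rfl⟩
  obtain ⟨a, rfl⟩ := Submodule.mem_span_singleton.1 hy
  rw [flow_smul, flow_of_mulVec_eq_smul hα₀ hα₁ h]
  exact Submodule.smul_mem _ _ (Submodule.smul_mem _ _ (Submodule.mem_span_singleton_self x))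

end Eigenvector

/-! ### The Jacobian obstruction -/

/-- Since `(1 - s)^(α-1) > 1` on `(0, 1)`, `B(α, α) > ∫₀¹ s^(α-1) ds = 1/α`, that is `α Γ(α)² >
Γ(2α)`. -/
theorem mlCoeff_one_sq_lt {α : ℝ} (hα₀ : 0 < α) (hα₁ : α < 1) :
    mlCoeff α 1 ^ 2 < 2 * mlCoeff α 2 := by
  have hG := Real.Gamma_pos_of_pos hα₀
  have hG2 := Real.Gamma_pos_of_pos (add_pos hα₀ hα₀)
  have hbeta := integral_rpow_mul_rpow_sub hα₀ hα₀ one_pos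
  rw [Real.one_rpow, one_mul] at hbeta
  have hint : IntegrableOn (fun s : ℝ => s ^ (α - 1) * (1 - s) ^ (α - 1)) (Ioc 0 1) := by
    refine Integrable.of_integral_ne_zero ?_
    rw [hbeta]
    positivity
  have hint1 : IntervalIntegrable (fun s : ℝ => s ^ (α - 1)) volume 0 1 :=
    intervalIntegral.intervalIntegrable_rpow' (by linarith)
  have hint2 := (intervalIntegrable_iff_integrableOn_Ioc_of_le zero_le_one).2 hint
  have hpos := intervalIntegral.intervalIntegral_pos_of_pos_on (hint2.sub hint1) (fun s hs => by
    have h1 : (1 : ℝ) < (1 - s) ^ (α - 1) :=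
      Real.one_lt_rpow_of_pos_of_lt_one_of_neg (sub_pos.2 hs.2) (by linarith [hs.1]) (by linarith)
    have h2 : 0 < s ^ (α - 1) := Real.rpow_pos_of_pos hs.1 _
    nlinarith) one_pos
  rw [intervalIntegral.integral_sub hint2 hint1, intervalIntegral.integral_of_le zero_le_one,
    hbeta, integral_rpow (Or.inl (by linarith)), sub_add_cancel, Real.one_rpow,
    Real.zero_rpow hα₀.ne', sub_zero, sub_pos, div_lt_div_iff₀ hα₀ hG2] at hpos
  have e1 : mlCoeff α 1 = (α * Real.Gamma α)⁻¹ := by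
    rw [mlCoeff, Nat.cast_one, mul_one, Real.Gamma_add_one hα₀.ne']
  have e2 : mlCoeff α 2 = (2 * α * Real.Gamma (α + α))⁻¹ := by
    rw [mlCoeff, Nat.cast_ofNat, Real.Gamma_add_one (by positivity), mul_comm α 2, two_mul α]
  have h3 : α * Real.Gamma (α + α) < (α * Real.Gamma α) ^ 2 := by nlinarith
  calc mlCoeff α 1 ^ 2 = ((α * Real.Gamma α) ^ 2)⁻¹ := by rw [e1, inv_pow]
    _ < (α * Real.Gamma (α + α))⁻¹ := inv_strictAnti₀ (by positivity) h3
    _ = 2 * mlCoeff α 2 := by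
      rw [e2]
      field_simp

section Jacobian

variable {E : Type*} [NormedAddCommGroup E] [NormedSpace ℝ E] [CompleteSpace E]

theorem surjective_of_det_ne_zero {L : ℝ × ℝ →L[ℝ] ℝ × ℝ} {p q : ℝ × ℝ} (hp : L (1, 0) = p)
    (hq : L (0, 1) = q) (hdet : p.1 * q.2 - p.2 * q.1 ≠ 0) : Function.Surjective L := by
  intro w
  -- Cramer's rule.
  refine ⟨((w.1 * q.2 - w.2 * q.1) / (p.1 * q.2 - p.2 * q.1),
    (p.1 * w.2 - p.2 * w.1) / (p.1 * q.2 - p.2 * q.1)), ?_⟩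
  have h : ∀ a b : ℝ, L (a, b) = a • p + b • q := by
    intro a b
    rw [← hp, ← hq, ← map_smul, ← map_smul, ← map_add]
    simp
  rw [h]
  ext
  · simp only [Prod.fst_add, Prod.smul_fst, smul_eq_mul]
    rw [div_mul_eq_mul_div, div_mul_eq_mul_div, ← add_div, div_eq_iff hdet]
    ring
  · simp only [Prod.snd_add, Prod.smul_snd, smul_eq_mul]
    rw [div_mul_eq_mul_div, div_mul_eq_mul_div, ← add_div, div_eq_iff hdet]
    ring

/-- If a `C¹` map on the open quadrant takes values in a `C¹` plane curve, its Jacobian vanishes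
there. -/
theorem jacobian_eq_zero_of_mem_curve {G : ℝ × ℝ → ℝ × ℝ} (hG : ContDiff ℝ 1 G) {γ : ℝ → ℝ × ℝ}
    (hγ : ContDiff ℝ 1 γ) (hmem : ∀ x y, 0 < x → 0 < y → G (x, y) ∈ range γ) {x y : ℝ}
    (hx : 0 < x) (hy : 0 < y) {p q : ℝ × ℝ} (hp : HasDerivAt (fun s => G (s, y)) p x)
    (hq : HasDerivAt (fun s => G (x, s)) q y) : p.1 * q.2 - p.2 * q.1 = 0 := by
  by_contra hdet
  have hstrict : HasStrictFDerivAt G (fderiv ℝ G (x, y)) (x, y) :=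
    hG.contDiffAt.hasStrictFDerivAt one_ne_zero
  have h1 := (hstrict.hasFDerivAt.comp_hasDerivAt x
    ((hasDerivAt_id x).prodMk (hasDerivAt_const x y))).unique hp
  have h2 := (hstrict.hasFDerivAt.comp_hasDerivAt y
    ((hasDerivAt_const y x).prodMk (hasDerivAt_id y))).unique hq
  -- A nonzero Jacobian makes `G` open at the point, so the curve would contain a planar
  -- neighbourhood; but the complement of a `C¹` curve in the plane is dense.
  have hmap := hstrict.map_nhds_eq_of_surj
    (LinearMap.range_eq_top.2 (surjective_of_det_ne_zero h1 h2 hdet))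
  have hnhds : range γ ∈ 𝓝 (G (x, y)) := by
    rw [← hmap, mem_map]
    filter_upwards [prod_mem_nhds (Ioi_mem_nhds hx) (Ioi_mem_nhds hy)] with r hr
    exact hmem r.1 r.2 hr.1 hr.2
  obtain ⟨z, hz1, hz2⟩ := (hγ.dense_compl_range_of_finrank_lt_finrank (by simp)).inter_nhds_nonempty
    hnhds
  exact hz1 hz2

/-- The functionals project to a plane in which `T v` and `T² v` become the standard basis. The
parameters replace `t ^ α`, so that the family is smooth at the origin too. -/
theorem exists_forall_ne_series_opCoeff {α : ℝ} (hα₀ : 0 < α) (hα₁ : α < 1) (T : E →L[ℝ] E) (v : E)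
    (φ ψ : E →L[ℝ] ℝ) (hφ1 : φ (T v) = 1) (hφ2 : φ (T (T v)) = 0) (hψ1 : ψ (T v) = 0)
    (hψ2 : ψ (T (T v)) = 1) :
    ∃ x y, 0 < x ∧ 0 < y ∧ ∀ z, series (opCoeff α T) x (series (opCoeff α T) y v)
      ≠ series (opCoeff α T) z v := by
  by_contra! hcon
  have hM := entireCoeff_opCoeff hα₀ hα₁ T
  have hM1 := hM.derivCoeff
  set M := series (opCoeff α T)
  set M₁ := series (derivCoeff (opCoeff α T))
  set M₂ := series (derivCoeff (derivCoeff (opCoeff α T)))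
  have hMd : ∀ x, HasDerivAt M (M₁ x) x := hM.hasDerivAt
  have hM1d : ∀ x, HasDerivAt M₁ (M₂ x) x := hM1.hasDerivAt
  have hMC : ContDiff ℝ 1 M := hM.contDiff
  have hMc : Continuous M := hM.continuous
  have hM1c : Continuous M₁ := hM1.continuous
  have hMv : ContDiff ℝ 1 fun y => M y v := hMC.clm_apply contDiff_const
  let P : E →L[ℝ] ℝ × ℝ := φ.prod ψ
  have hjac : ∀ x y, 0 < x → 0 < y →
      φ (M₁ x (M y v)) * ψ (M x (M₁ y v)) - ψ (M₁ x (M y v)) * φ (M x (M₁ y v)) = 0 := by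
    intro x y hx hy
    refine jacobian_eq_zero_of_mem_curve (G := fun r => P (M r.1 (M r.2 v)))
      (γ := fun z => P (M z v)) (P.contDiff.comp ((hMC.comp contDiff_fst).clm_apply
        (hMv.comp contDiff_snd))) (P.contDiff.comp hMv) (fun x y hx hy => ?_) hx hy
      (p := P (M₁ x (M y v))) (q := P (M x (M₁ y v))) ?_ ?_
    · obtain ⟨z, hz⟩ := hcon x y hx hy
      exact ⟨z, by simp only [hz]⟩
    · exact P.hasFDerivAt.comp_hasDerivAt x
        ((ContinuousLinearMap.apply ℝ E (M y v)).hasFDerivAt.comp_hasDerivAt x (hMd x))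
    · exact P.hasFDerivAt.comp_hasDerivAt y ((M x).hasFDerivAt.comp_hasDerivAt y
        ((ContinuousLinearMap.apply ℝ E v).hasFDerivAt.comp_hasDerivAt y (hMd y)))
  have hM0 : M 0 = 1 := by simp [M, series_zero, opCoeff]
  have hM10 : M₁ 0 = mlCoeff α 1 • T := by simp [M₁, series_zero, opCoeff, derivCoeff]
  have hM20 : M₂ 0 = (2 * mlCoeff α 2) • T ^ 2 := by
    simp only [M₂, series_zero, opCoeff, derivCoeff]
    norm_num [smul_smul]
  -- The Jacobian vanishes only on the open quadrant; continuity carries this to `y = 0`, and then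
  -- to `x = 0`.
  have hclos : ∀ f : ℝ → ℝ, Continuous f → (∀ x, 0 < x → f x = 0) → ∀ x, 0 ≤ x → f x = 0 := by
    intro f hf h x hx
    refine (show EqOn f (fun _ => 0) (Ioi 0) from h).closure hf continuous_const ?_
    rwa [closure_Ioi, mem_Ici]
  set D : ℝ → ℝ := fun x =>
    φ (M₁ x v) * ψ (M x (mlCoeff α 1 • T v)) - ψ (M₁ x v) * φ (M x (mlCoeff α 1 • T v))
  have hD : ∀ x, 0 ≤ x → D x = 0 := by
    refine hclos D (by fun_prop) fun x hx => ?_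
    have h := hclos (fun y => φ (M₁ x (M y v)) * ψ (M x (M₁ y v))
      - ψ (M₁ x (M y v)) * φ (M x (M₁ y v))) (by fun_prop) (fun y hy => hjac x y hx hy) 0 le_rfl
    simpa only [hM0, hM10, one_apply_eq_self, smul_apply] using h
  have hder : ∀ (χ : E →L[ℝ] ℝ) (w : E) {N : ℝ → E →L[ℝ] E} {N' : E →L[ℝ] E},
      HasDerivAt N N' 0 → HasDerivAt (fun x => χ (N x w)) (χ (N' w)) 0 := fun χ w N N' hN =>
    χ.hasFDerivAt.comp_hasDerivAt 0
      ((ContinuousLinearMap.apply ℝ E w).hasFDerivAt.comp_hasDerivAt 0 hN)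
  have hDd := ((hder φ v (hM1d 0)).mul (hder ψ (mlCoeff α 1 • T v) (hMd 0))).sub
    ((hder ψ v (hM1d 0)).mul (hder φ (mlCoeff α 1 • T v) (hMd 0)))
  -- `D` is known to vanish only for `x ≥ 0`, hence the one-sided derivative.
  have hD0 : HasDerivWithinAt D 0 (Ici 0) 0 :=
    (hasDerivWithinAt_const 0 (Ici 0) (0 : ℝ)).congr (fun x hx => hD x hx) (hD 0 le_rfl)
  have heq := (uniqueDiffOn_Ici (0 : ℝ) 0 self_mem_Ici).eq_deriv _
    (HasDerivAt.hasDerivWithinAt hDd) hD0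
  simp only [hM0, hM10, hM20, one_apply_eq_self, smul_apply, map_smul, pow_two, mul_apply_eq_comp,
    hφ1, hφ2, hψ1, hψ2, smul_eq_mul] at heq
  have hc := mlCoeff_pos hα₀ 1
  have hlt := mlCoeff_one_sq_lt hα₀ hα₁
  -- `heq` amounts to `c₁ (c₁² - 2 c₂) = 0`, with `c₁ > 0` and `c₁² < 2 c₂`.
  nlinarith

end Jacobian

/-! ### Non-invariance off the eigenvectors -/

section NotInvariant

variable {n : ℕ}

theorem exists_dual_pair {V : Type*} [NormedAddCommGroup V] [NormedSpace ℝ V]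
    [FiniteDimensional ℝ V] {u w : V} (h : LinearIndependent ℝ ![u, w]) :
    ∃ φ ψ : V →L[ℝ] ℝ, φ u = 1 ∧ φ w = 0 ∧ ψ u = 0 ∧ ψ w = 1 := by
  obtain ⟨g, hg⟩ := LinearMap.exists_leftInverse_of_injective
    (Fintype.linearCombination ℝ ![u, w]) (LinearMap.ker_eq_bot.2 h.fintypeLinearCombination_injective)
  have hu : g u = Pi.single 0 1 := by
    have := LinearMap.congr_fun hg (Pi.single 0 1)
    simpa using this
  have hw : g w = Pi.single 1 1 := by
    have := LinearMap.congr_fun hg (Pi.single 1 1)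
    simpa using this
  refine ⟨LinearMap.toContinuousLinearMap (LinearMap.proj 0 ∘ₗ g),
    LinearMap.toContinuousLinearMap (LinearMap.proj 1 ∘ₗ g), ?_, ?_, ?_, ?_⟩ <;>
  simp [hu, hw]

theorem not_isInvariant_solutionCurve {α : ℝ} (hα₀ : 0 < α) (hα₁ : α < 1)
    {A : Matrix (Fin n) (Fin n) ℝ} {x : Fin n → ℝ}
    (h : LinearIndependent ℝ ![A.mulVec x, A.mulVec (A.mulVec x)]) :
    ¬ IsInvariant α A (solutionCurve α A x) := by
  intro hinv
  obtain ⟨φ, ψ, h1, h2, h3, h4⟩ := exists_dual_pair h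
  obtain ⟨a, b, ha, hb, hab⟩ :=
    exists_forall_ne_series_opCoeff hα₀ hα₁ (matrixCLM A) x φ ψ h1 h2 h3 h4
  have hflow : ∀ t y, flow α A t y = series (opCoeff α (matrixCLM A)) (t ^ α) y := fun t y => by
    rw [flow_eq_orbit hα₀ hα₁, orbit, series_opCoeff_apply hα₀ hα₁]
  -- The times `a ^ α⁻¹` and `b ^ α⁻¹` realise the series parameters `a` and `b`.
  have hpow : ∀ c : ℝ, 0 < c → (c ^ α⁻¹) ^ α = c := fun c hc =>
    Real.rpow_inv_rpow hc.le hα₀.ne'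
  obtain ⟨z, -, hz⟩ := hinv (a ^ α⁻¹) (by positivity)
    ⟨_, ⟨b ^ α⁻¹, (by positivity : (0 : ℝ) ≤ b ^ α⁻¹), rfl⟩, rfl⟩
  simp only [hflow, hpow a ha, hpow b hb] at hz
  exact hab (z ^ α) hz.symm

theorem linearIndependent_or_exists_smul {A : Matrix (Fin n) (Fin n) ℝ} {x : Fin n → ℝ}
    (hx : ¬ OnEigenvector A x) :
    LinearIndependent ℝ ![A.mulVec x, A.mulVec (A.mulVec x)] ∨
      ∃ c : ℝ, A.mulVec (A.mulVec x) = c • A.mulVec x := by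
  have h0 : A.mulVec x ≠ 0 := fun h => hx ⟨0, by rw [h, zero_smul]⟩
  by_cases h : ∃ c : ℝ, A.mulVec (A.mulVec x) = c • A.mulVec x
  · exact Or.inr h
  · left
    rw [LinearIndependent.pair_iff' h0]
    exact fun c hc => h ⟨c, hc.symm⟩

/-- As `A x` satisfies the eigenvector equation, `A` maps the curve to scalar multiples of `A x`;
the Volterra equation then moves the point from `x` only in the direction `A x`. -/
theorem collinear_solutionCurve {α : ℝ} (hα₀ : 0 < α) (hα₁ : α < 1)
    {A : Matrix (Fin n) (Fin n) ℝ} {x : Fin n → ℝ} {c : ℝ}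
    (h : A.mulVec (A.mulVec x) = c • A.mulVec x) : Collinear ℝ (solutionCurve α A x) := by
  rw [collinear_iff_exists_forall_eq_smul_vadd]
  refine ⟨x, A.mulVec x, ?_⟩
  rintro _ ⟨t, ht, rfl⟩
  rcases (mem_Ici.1 ht).eq_or_lt with rfl | ht
  · exact ⟨0, by simp [flow_eq_orbit hα₀ hα₁, orbit_zero hα₀]⟩
  refine ⟨rlInt α (scalarOrbit α c) t, ?_⟩
  have hA : ∀ s, 0 < s → matrixCLM A (orbit α (matrixCLM A) x s)
      = scalarOrbit α c s • A.mulVec x := by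
    intro s hs
    rw [← flow_of_mulVec_eq_smul hα₀ hα₁ h, flow_eq_orbit hα₀ hα₁, map_orbit_eq_tsum hα₀ hα₁ _ _ hs,
      orbit_eq_tsum _ _ _ hs]
    simp only [pow_succ, mul_apply_eq_comp, matrixCLM_apply]
  simp only [flow_eq_orbit hα₀ hα₁]
  rw [orbit_eq_add_rlInt hα₀ hα₁ _ _ ht, rlInt_congr α fun s hs _ => hA s hs, vadd_eq_add, add_comm]
  congr 1
  simp only [rlInt, ← smul_assoc]
  exact integral_smul_const _ _

theorem onEigenvector_of_det_ne_zero {A : Matrix (Fin n) (Fin n) ℝ} (hdet : A.det ≠ 0)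
    {x : Fin n → ℝ} {c : ℝ} (h : A.mulVec (A.mulVec x) = c • A.mulVec x) : OnEigenvector A x := by
  refine ⟨c, sub_eq_zero.1 (Matrix.eq_zero_of_mulVec_eq_zero hdet ?_)⟩
  rw [Matrix.mulVec_sub, Matrix.mulVec_smul, h, sub_self]

end NotInvariant

end FracLin

end

/-! ### The main theorem -/

theorem mainTheorem3 (n : ℕ) (α : ℝ) (hα₀ : 0 < α) (hα₁ : α < 1)
    (A : Matrix (Fin n) (Fin n) ℝ) :
    -- the Mittag-Leffler series converge
    (∀ c : ℝ, Summable fun k : ℕ => (Real.Gamma (α * k + 1))⁻¹ • c ^ k) ∧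
    (∀ M : Matrix (Fin n) (Fin n) ℝ,
      Summable fun k : ℕ => (Real.Gamma (α * k + 1))⁻¹ • M ^ k) ∧
    -- the unique solution of the initial value problem is `E_α(A t ^ α) X₀`
    (∀ (X₀ : Fin n → ℝ) (X : ℝ → Fin n → ℝ),
      FracLin.IsSolution α A X₀ X ↔
        ∀ t : ℝ, 0 ≤ t → X t = (FracLin.mittagLeffler α (t ^ α • A)).mulVec X₀) ∧
    -- initial point on an eigenvector: the curve stays on its line; curve and line are invariant
    (∀ (X₀ : Fin n → ℝ) (c : ℝ), A.mulVec X₀ = c • X₀ →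
      (∀ t : ℝ, 0 ≤ t → FracLin.flow α A t X₀ = FracLin.mittagLeffler α (c * t ^ α) • X₀) ∧
      FracLin.IsInvariant α A (FracLin.solutionCurve α A X₀) ∧
      FracLin.IsInvariant α A (Submodule.span ℝ {X₀} : Set (Fin n → ℝ))) ∧
    -- initial point not on an eigenvector: a curve that is not straight is not invariant
    (∀ X₀ : Fin n → ℝ, ¬ FracLin.OnEigenvector A X₀ →
      ¬ Collinear ℝ (FracLin.solutionCurve α A X₀) →
      ¬ FracLin.IsInvariant α A (FracLin.solutionCurve α A X₀)) ∧
    -- for nonsingular `A` no exception is needed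
    (A.det ≠ 0 → ∀ X₀ : Fin n → ℝ, ¬ FracLin.OnEigenvector A X₀ →
      ¬ FracLin.IsInvariant α A (FracLin.solutionCurve α A X₀)) := by
  refine ⟨fun c => ?_, FracLin.summable_mittagLeffler_matrix hα₀ hα₁, fun X₀ X => ⟨?_, ?_⟩,
    fun X₀ c h => ⟨?_, ?_, ?_⟩, fun X₀ hX₀ hcol => ?_, fun hdet X₀ hX₀ => ?_⟩
  · exact (FracLin.summable_pow_mul_mlCoeff hα₀ hα₁ c).congr fun k => mul_comm _ _
  · intro h t ht
    rw [h.eq_orbit hα₀ hα₁ ht, FracLin.mittagLeffler_mulVec hα₀ hα₁, FracLin.orbit]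
  · intro h
    refine FracLin.isSolution_of_eq_orbit hα₀ hα₁ fun t ht => ?_
    rw [h t ht, FracLin.mittagLeffler_mulVec hα₀ hα₁, FracLin.orbit]
  · exact fun t _ => FracLin.flow_of_mulVec_eq_smul hα₀ hα₁ h t
  · exact FracLin.isInvariant_solutionCurve_of_mulVec_eq_smul hα₀ hα₁ h
  · exact FracLin.isInvariant_span_of_mulVec_eq_smul hα₀ hα₁ h
  · rcases FracLin.linearIndependent_or_exists_smul hX₀ with h | ⟨c, h⟩
    · exact FracLin.not_isInvariant_solutionCurve hα₀ hα₁ h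
    · exact absurd (FracLin.collinear_solutionCurve hα₀ hα₁ h) hcol
  · rcases FracLin.linearIndependent_or_exists_smul hX₀ with h | ⟨c, h⟩
    · exact FracLin.not_isInvariant_solutionCurve hα₀ hα₁ h
    · exact absurd (FracLin.onEigenvector_of_det_ne_zero hdet h) hX₀
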